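/- Fix $L>0$ and let $\mathbb{T}^2=(\mathbb{R}/L\mathbb{Z})^2$ be the flat torus, each tangent space $T_z\mathbb{T}^2$ being identified with $\mathbb{R}^2$ with the Euclidean norm. Let $a_0<b_0<a_1<b_1<a_0+L$ and $c_0<d_0<c_1<d_1<c_0+L$ be real numbers and let $k_0,k_1,l_0,l_1\ge 1$ be integers. Let $P_i=\{(x,y):y\in[a_i,b_i]\bmod L\}$ and $Q_i=\{(x,y):x\in[c_i,d_i]\bmod L\}$ ($i=0,1$), with boundaries $\partial P_i=\{(x,y): y\in\{a_i,b_i\}\}$ and $\partial Q_i=\{(x,y):x\in\{c_i,d_i\}\}$ (mod $L$). Put $P=P_0\cup P_1$, $Q=Q_0\cup Q_1$, $\partial P=\partial P_0\cup\partial P_1$, $\partial Q=\partial Q_0\cup\partial Q_1$ and $R=P\cup Q$. Let $f:\mathbb{R}/L\mathbb{Z}\to\mathbb{R}/L\mathbb{Z}$ be the piecewise linear twist function with $f(y)=k_iL\,\frac{y-a_i}{b_i-a_i}\bmod L$ for $y\in[a_i,b_i]$ and $f=0$ elsewhere, and let $g$ be defined likewise by $g(x)=l_iL\,\frac{x-c_i}{d_i-c_i}\bmod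 L$ for $x\in[c_i,d_i]$ and $g=0$ elsewhere. Let $F(x,y)=(x+f(y),y)$, $G(x,y)=(x,y+g(x))$ and let $H=G\circ F$ be the linked-twist map. Let $\mu$ be the normalized Lebesgue measure on $R$, $\mu(A)=\mathrm{Leb}(A\cap R)/\mathrm{Leb}(R)$. Let $s_0=\partial P\cup F^{-1}(\partial Q)$, $V=R\setminus s_0$, $N=V\setminus H^{-1}(s_0)$ and $J=\bigcap_{i\in\mathbb{Z}}H^i(N)$. Then the Lyapunov exponents of $H|_N$ exist for $\mu$-a.e. $z\in R$ and every non-zero tangent vector. That is, for $\mu$-a.e. $z\in R$ one has $z\in J$, every iterate $H^n$ ($n\in\mathbb{Z}$) is differentiable at $z$, and for every non-zero $v\in T_z\mathbb{T}^2$ both limits $$\chi^{+}(z,v)=\lim_{n\to+\infty}\frac1n\log\|DH^n_z v\|,\qquad \chi^{-}(z,v)=\lim_{n\to-\infty}\frac1n\log\|DH^n_z v\|$$ exist and are finite. -/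

import Mathlib

noncomputable section

/-- The flat two-torus of side length `L`. -/
abbrev Torus (L : ℝ) : Type := AddCircle L × AddCircle L

/-- The tangent space `T_z 𝕋²`, identified with the Euclidean plane. -/
abbrev Tangent : Type := EuclideanSpace ℝ (Fin 2)

/-- Two disjoint closed arcs `[lo i, hi i]` (mod `L`) of the circle `ℝ / L ℤ`, each with
the number of times `wrap i ≥ 1` that the twist supported on it wraps around the circle. -/
structure TwistData (L : ℝ) where
  lo : Fin 2 → ℝ
  hi : Fin 2 → ℝ
  wrap : Fin 2 → ℕ
  lo_zero_lt_hi_zero : lo 0 < hi 0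
  hi_zero_lt_lo_one : hi 0 < lo 1
  lo_one_lt_hi_one : lo 1 < hi 1
  hi_one_lt : hi 1 < lo 0 + L
  wrap_pos : ∀ i, 0 < wrap i

namespace TwistData

variable {L : ℝ} (T : TwistData L)

/-- The `i`-th arc on the circle. -/
def arc (i : Fin 2) : Set (AddCircle L) :=
  (fun t : ℝ => (t : AddCircle L)) '' Set.Icc (T.lo i) (T.hi i)

/-- The union of the two arcs. -/
def arcs : Set (AddCircle L) := ⋃ i, T.arc i

/-- The four endpoints of the two arcs. -/
def endpoints : Set (AddCircle L) :=
  {y | ∃ i, y = (T.lo i : AddCircle L) ∨ y = (T.hi i : AddCircle L)}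

variable [Fact (0 < L)]

/-- The piecewise linear twist supported on the `i`-th arc. With `t` the representative in
`[lo i, lo i + L)`, it is linear from `0` to `wrap i * L ≡ 0` on the arc, and `0` off it. -/
def twistOn (i : Fin 2) (y : AddCircle L) : AddCircle L :=
  let t : ℝ := (AddCircle.equivIco L (T.lo i) y : ℝ)
  if t ≤ T.hi i then
    (((T.wrap i : ℝ) * L * ((t - T.lo i) / (T.hi i - T.lo i)) : ℝ) : AddCircle L)
  else 0

/-- The twist function of the circle; it vanishes off the two arcs. -/
def twist (y : AddCircle L) : AddCircle L := ∑ i, T.twistOn i y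

end TwistData

/-- A toral linked-twist map on four annuli: `p` describes the horizontal annuli `P₀, P₁`
(and the twist function `f` of `y`), `q` the vertical annuli `Q₀, Q₁` (and `g` of `x`). -/
structure LinkedTwist (L : ℝ) where
  p : TwistData L
  q : TwistData L

namespace LinkedTwist

variable {L : ℝ} (Λ : LinkedTwist L)

/-- `P = P₀ ∪ P₁`. -/
def P : Set (Torus L) := {z | z.2 ∈ Λ.p.arcs}

/-- `Q = Q₀ ∪ Q₁`. -/
def Q : Set (Torus L) := {z | z.1 ∈ Λ.q.arcs}

/-- The union of the four annuli. -/
def R : Set (Torus L) := Λ.P ∪ Λ.Q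

/-- `∂P = ∂P₀ ∪ ∂P₁`. -/
def bdP : Set (Torus L) := {z | z.2 ∈ Λ.p.endpoints}

/-- `∂Q = ∂Q₀ ∪ ∂Q₁`. -/
def bdQ : Set (Torus L) := {z | z.1 ∈ Λ.q.endpoints}

variable [Fact (0 < L)]

/-- The horizontal twist `F (x, y) = (x + f y, y)`. -/
def F : Equiv.Perm (Torus L) where
  toFun z := (z.1 + Λ.p.twist z.2, z.2)
  invFun z := (z.1 - Λ.p.twist z.2, z.2)
  left_inv z := by simp
  right_inv z := by simp

/-- The vertical twist `G (x, y) = (x, y + g x)`. -/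
def G : Equiv.Perm (Torus L) where
  toFun z := (z.1, z.2 + Λ.q.twist z.1)
  invFun z := (z.1, z.2 - Λ.q.twist z.1)
  left_inv z := by simp
  right_inv z := by simp

/-- The linked-twist map `H = G ∘ F`. -/
def H : Equiv.Perm (Torus L) := Λ.G * Λ.F

/-- The set `s₀ = ∂P ∪ F⁻¹(∂Q)` off which `H` is differentiable. -/
def s₀ : Set (Torus L) := Λ.bdP ∪ Λ.F ⁻¹' Λ.bdQ

/-- `V = R \ s₀`. -/
def V : Set (Torus L) := Λ.R \ Λ.s₀

/-- `N = V \ H⁻¹(s₀)`. -/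
def N : Set (Torus L) := Λ.V \ Λ.H ⁻¹' Λ.s₀

/-- The intersection of all images and pre-images of `N`, that is, the set of points at which
every iterate, forward and backward, of the restriction `H|_N` is defined and lies in `N`. -/
def J : Set (Torus L) := ⋂ i : ℤ, (Λ.H ^ i : Equiv.Perm (Torus L)) '' Λ.N

/-- Normalized Lebesgue measure on `R`: `μ(A) = Leb(A ∩ R) / Leb(R)`. -/
def μ : MeasureTheory.Measure (Torus L) :=
  ProbabilityTheory.cond MeasureTheory.volume Λ.R

end LinkedTwist

/-- The exponential map of the flat torus at `z`. -/
def torusExp {L : ℝ} (z : Torus L) (h : Tangent) : Torus L :=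
  (z.1 + (h 0 : AddCircle L), z.2 + (h 1 : AddCircle L))

variable {L : ℝ} [Fact (0 < L)]

/-- The representative in `[-L/2, L/2)²` of a point of the torus. Near `0` it is the inverse
of the exponential map at `0`. -/
def torusLog (w : Torus L) : Tangent :=
  !₂[(AddCircle.equivIco L (-(L / 2)) w.1 : ℝ), (AddCircle.equivIco L (-(L / 2)) w.2 : ℝ)]

/-- The expression of `φ : 𝕋² → 𝕋²` in the exponential charts centred at `z` and `φ z`. -/
def torusLocal (φ : Torus L → Torus L) (z : Torus L) (h : Tangent) : Tangent :=
  torusLog (φ (torusExp z h) - φ z)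

/-- Differentiability of a self-map of the torus at a point. -/
def TorusDifferentiableAt (φ : Torus L → Torus L) (z : Torus L) : Prop :=
  DifferentiableAt ℝ (torusLocal φ z) 0

/-- The derivative `Dφ_z : T_z 𝕋² → T_{φ z} 𝕋²` (zero if `φ` is not differentiable at `z`). -/
def torusDeriv (φ : Torus L → Torus L) (z : Torus L) : Tangent →L[ℝ] Tangent :=
  fderiv ℝ (torusLocal φ z) 0

/-- The number `χ` is the limit of `(1/n) log ‖Dφⁿ_z v‖` as `n` tends along the filter `l` on
`ℤ`. The forward exponent is the case `n → +∞`, the backward exponent `n → -∞`. -/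
def IsLyapunovExponent (φ : Equiv.Perm (Torus L)) (l : Filter ℤ) (z : Torus L) (v : Tangent)
    (χ : ℝ) : Prop :=
  Filter.Tendsto
    (fun n : ℤ => (1 / (n : ℝ)) * Real.log ‖torusDeriv (φ ^ n : Equiv.Perm (Torus L)) z v‖)
    l (nhds χ)

end

/-! Off the null set `s₀` the map `H` is locally affine, and its derivative is a horizontal shear
followed by a vertical one, both with non-negative slopes. Such products have determinant one and
non-negative entries, so they preserve the first quadrant, and their inverses preserve the second.
Positivity replaces the general multiplicative ergodic theorem: pushing a coordinate axis forward
from ever earlier points of the orbit gives directions that move monotonically inside the quadrant,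
hence converge at every point to an invariant field (`exists_measurable_invariant_direction`). The
same construction for `H⁻¹` gives an invariant field in the second quadrant.

Along an invariant field the logarithm of the norm of the iterated derivative is, up to a bounded
error, a Birkhoff sum of the logarithm of the stretching rate, which is bounded and measurable.
Birkhoff's theorem (`ae_exists_tendsto_birkhoffAverage`) therefore gives growth rates along both
fields almost everywhere. Where the fields are transversal, the forward derivatives are bounded on
the second field and preserve area, so every vector off that field grows like the first field
(`exists_tendsto_log_norm_of_transversal`). In backward time the two fields exchange roles.

Where the fields coincide, they lie on a coordinate axis. Invariance then annihilates one of the two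
shears along the whole forward orbit and along the whole backward orbit, growth is at most linear,
and all exponents are zero (`tendsto_log_norm_of_shears`).

The argument runs on the whole torus, where `H` preserves Lebesgue measure; absolute continuity
carries it over to `μ`. -/

open MeasureTheory Filter Topology

/-! ### Birkhoff's ergodic theorem for bounded functions -/

section BirkhoffTheorem

variable {X : Type*}

/-- The maximum of `0` and the first `n` Birkhoff sums of `f`. -/
noncomputable def birkhoffMax (T : X → X) (f : X → ℝ) : ℕ → X → ℝ
  | 0, _ => 0
  | n + 1, x => max 0 (f x + birkhoffMax T f n (T x))

lemma birkhoffMax_nonneg (T : X → X) (f : X → ℝ) (n : ℕ) (x : X) : 0 ≤ birkhoffMax T f n x := by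
  cases n
  · exact le_rfl
  · exact le_max_left _ _

lemma birkhoffMax_le_succ (T : X → X) (f : X → ℝ) (n : ℕ) :
    ∀ x, birkhoffMax T f n x ≤ birkhoffMax T f (n + 1) x := by
  induction n with
  | zero => intro x; exact birkhoffMax_nonneg T f 1 x
  | succ n ih =>
    intro x
    exact max_le_max le_rfl (by linarith [ih (T x)])

lemma birkhoffSum_le_birkhoffMax (T : X → X) (f : X → ℝ) (n : ℕ) :
    ∀ x, birkhoffSum T f n x ≤ birkhoffMax T f n x := by
  induction n with
  | zero => intro x; simp [birkhoffMax]
  | succ n ih =>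
    intro x
    rw [birkhoffSum_succ']
    exact le_max_of_le_right (by linarith [ih (T x)])

lemma birkhoffMax_le (T : X → X) (f : X → ℝ) {K : ℝ} (hf : ∀ x, |f x| ≤ K) (n : ℕ) :
    ∀ x, birkhoffMax T f n x ≤ n * K := by
  induction n with
  | zero => intro x; simp [birkhoffMax]
  | succ n ih =>
    intro x
    have h1 := ih (T x)
    have h2 := hf x
    have h3 := abs_nonneg (f x)
    have h4 := le_abs_self (f x)
    have h5 := birkhoffMax_nonneg T f n (T x)
    push_cast
    exact max_le (by nlinarith) (by linarith)

/-- The points at which the Birkhoff sums of `f` are unbounded above. -/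
def birkhoffUnbounded (T : X → X) (f : X → ℝ) : Set X :=
  {x | ∀ C : ℕ, ∃ n, (C : ℝ) < birkhoffSum T f n x}

/-- Passing from `x` to `T x` changes the sums by the single term `f x`, which is bounded. This
makes the unbounded set invariant under preimage, so the maximal ergodic theorem can be applied on
it. -/
lemma apply_mem_birkhoffUnbounded_iff {T : X → X} {f : X → ℝ} {K : ℝ} (hK : ∀ x, |f x| ≤ K)
    (x : X) : T x ∈ birkhoffUnbounded T f ↔ x ∈ birkhoffUnbounded T f := by
  obtain ⟨k, hk⟩ := exists_nat_ge K
  have hx := abs_le.1 ((hK x).trans hk)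
  constructor
  · intro h C
    obtain ⟨n, hn⟩ := h (C + k)
    refine ⟨n + 1, ?_⟩
    rw [birkhoffSum_succ']
    push_cast at hn
    linarith
  · intro h C
    obtain ⟨n, hn⟩ := h (C + k)
    push_cast at hn
    cases n with
    | zero =>
      simp only [birkhoffSum_zero] at hn
      have : (0 : ℝ) ≤ (C : ℝ) + k := by positivity
      linarith
    | succ n =>
      refine ⟨n, ?_⟩
      rw [birkhoffSum_succ'] at hn
      linarith

lemma mem_birkhoffUnbounded_of_frequently {T : X → X} {f : X → ℝ} {δ : ℝ} (hδ : 0 < δ) {x : X}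
    (h : ∃ᶠ n : ℕ in atTop, n * δ ≤ birkhoffSum T f n x) : x ∈ birkhoffUnbounded T f := by
  intro C
  obtain ⟨n, hn, hn'⟩ := (h.and_eventually
    ((tendsto_natCast_atTop_atTop.atTop_mul_const hδ).eventually_gt_atTop (C : ℝ))).exists
  exact ⟨n, hn'.trans_le hn⟩

variable [MeasurableSpace X]

lemma measurable_birkhoffMax {T : X → X} (hT : Measurable T) {f : X → ℝ} (hf : Measurable f)
    (n : ℕ) : Measurable (birkhoffMax T f n) := by
  induction n with
  | zero => exact measurable_const
  | succ n ih => exact measurable_const.max (hf.add (ih.comp hT))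

lemma measurable_birkhoffSum {T : X → X} (hT : Measurable T) {f : X → ℝ} (hf : Measurable f)
    (n : ℕ) : Measurable (birkhoffSum T f n) :=
  Finset.measurable_fun_sum _ fun k _ => hf.comp (hT.iterate k)

/-- **Maximal ergodic theorem** for a bounded function some Birkhoff sum of which is positive at
almost every point. -/
lemma integral_nonneg_of_exists_birkhoffSum_pos {μ : Measure X} [IsFiniteMeasure μ] {T : X → X}
    (hT : MeasurePreserving T μ μ) {f : X → ℝ} (hf : Measurable f) {K : ℝ}
    (hK : ∀ x, |f x| ≤ K) (hpos : ∀ᵐ x ∂μ, ∃ n, 0 < birkhoffSum T f n x) :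
    0 ≤ ∫ x, f x ∂μ := by
  have hfi : Integrable f μ := .of_bound hf.aestronglyMeasurable K (.of_forall hK)
  have hmeas := measurable_birkhoffMax hT.measurable hf
  have hMi (n : ℕ) : Integrable (birkhoffMax T f n) μ :=
    .of_bound (hmeas n).aestronglyMeasurable (n * K) (.of_forall fun x => by
      rw [Real.norm_of_nonneg (birkhoffMax_nonneg T f n x)]
      exact birkhoffMax_le T f hK n x)
  have hMTi (n : ℕ) : Integrable (fun x => birkhoffMax T f n (T x)) μ :=
    hT.integrable_comp_of_integrable (hMi n)
  set E : ℕ → Set X := fun n => {x | 0 < birkhoffMax T f n x} with hE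
  have hEm (n : ℕ) : MeasurableSet (E n) := measurableSet_lt measurable_const (hmeas n)
  have hEmono : Monotone E :=
    monotone_nat_of_le_succ fun n x hx => lt_of_lt_of_le hx (birkhoffMax_le_succ T f n x)
  -- Where the maximum `M` of index `n + 1` is positive, `M x = f x + birkhoffMax T f n (T x) ≤ f x
  -- + M (T x)`; elsewhere `M x = 0 ≤ M (T x)`. Integrating `M - M ∘ T`, whose integral vanishes by
  -- invariance, gives the claim.
  have hstep (n : ℕ) : 0 ≤ ∫ x in E (n + 1), f x ∂μ := by
    have hle : ∀ x, birkhoffMax T f (n + 1) x - birkhoffMax T f (n + 1) (T x)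
        ≤ (E (n + 1)).indicator f x := by
      intro x
      by_cases hx : x ∈ E (n + 1)
      · rw [Set.indicator_of_mem hx]
        have h0 : 0 < max 0 (f x + birkhoffMax T f n (T x)) := hx
        have h1 : birkhoffMax T f (n + 1) x = f x + birkhoffMax T f n (T x) := by
          rcases max_cases 0 (f x + birkhoffMax T f n (T x)) with h | h
          · linarith
          · exact h.1
        linarith [birkhoffMax_le_succ T f n (T x)]
      · rw [Set.indicator_of_notMem hx]
        have h1 : birkhoffMax T f (n + 1) x ≤ 0 := not_lt.mp hx
        linarith [birkhoffMax_nonneg T f (n + 1) (T x)]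
    rw [← integral_indicator (hEm _)]
    refine le_trans (le_of_eq ?_) (integral_mono ((hMi (n + 1)).sub (hMTi (n + 1)))
      (hfi.indicator (hEm _)) hle)
    have hcomp : ∫ x, birkhoffMax T f (n + 1) (T x) ∂μ = ∫ x, birkhoffMax T f (n + 1) x ∂μ := by
      conv_rhs => rw [← hT.map_eq]
      exact (integral_map hT.measurable.aemeasurable
        (hmeas (n + 1)).aestronglyMeasurable).symm
    have := integral_sub (hMi (n + 1)) (hMTi (n + 1))
    simp only [Pi.sub_apply]
    rw [this, hcomp, sub_self]
  have hlim := tendsto_setIntegral_of_monotone (μ := μ) (f := f) hEm hEmono hfi.integrableOn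
  have hae : ∀ᵐ x ∂μ, x ∈ ⋃ n, E n := by
    filter_upwards [hpos] with x ⟨n, hn⟩
    exact Set.mem_iUnion.2 ⟨n, hn.trans_le (birkhoffSum_le_birkhoffMax T f n x)⟩
  rw [setIntegral_eq_integral_of_ae_compl_eq_zero
    (by filter_upwards [hae] with x hx hx'; exact absurd hx hx')] at hlim
  exact ge_of_tendsto ((tendsto_add_atTop_iff_nat 1).2 hlim) (.of_forall hstep)

lemma measurableSet_birkhoffUnbounded {T : X → X} (hT : Measurable T) {f : X → ℝ}
    (hf : Measurable f) : MeasurableSet (birkhoffUnbounded T f) := by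
  have : birkhoffUnbounded T f = ⋂ C : ℕ, ⋃ n : ℕ, {x | (C : ℝ) < birkhoffSum T f n x} := by
    ext x; simp [birkhoffUnbounded]
  rw [this]
  exact .iInter fun C => .iUnion fun n =>
    measurableSet_lt measurable_const (measurable_birkhoffSum hT hf n)

/-- Almost no point has Birkhoff averages that oscillate across the interval `[a, b]`. -/
lemma measure_birkhoffUnbounded_inter_eq_zero {μ : Measure X} [IsFiniteMeasure μ] {T : X → X}
    (hT : MeasurePreserving T μ μ) {f : X → ℝ} (hf : Measurable f) {K : ℝ}
    (hK : ∀ x, |f x| ≤ K) {a b : ℝ} (hab : a < b) :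
    μ (birkhoffUnbounded T (fun x => f x - b) ∩ birkhoffUnbounded T (fun x => a - f x)) = 0 := by
  have hKb : ∀ x, |f x - b| ≤ K + |b| := fun x => (abs_sub _ _).trans (by linarith [hK x])
  have hKa : ∀ x, |a - f x| ≤ K + |a| := fun x => (abs_sub _ _).trans (by linarith [hK x])
  have hbm : Measurable fun x => f x - b := hf.sub_const b
  have ham : Measurable fun x => a - f x := hf.const_sub a
  set E := birkhoffUnbounded T (fun x => f x - b) ∩ birkhoffUnbounded T (fun x => a - f x)
  have hEm : MeasurableSet E := (measurableSet_birkhoffUnbounded hT.measurable hbm).inter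
    (measurableSet_birkhoffUnbounded hT.measurable ham)
  have hinv : T ⁻¹' E = E := by
    ext x
    exact and_congr (apply_mem_birkhoffUnbounded_iff hKb x) (apply_mem_birkhoffUnbounded_iff hKa x)
  have hTE : MeasurePreserving T (μ.restrict E) (μ.restrict E) := by
    have := hT.restrict_preimage hEm
    rwa [hinv] at this
  have hE : ∀ᵐ x ∂μ.restrict E, x ∈ E := ae_restrict_mem hEm
  have h1 := integral_nonneg_of_exists_birkhoffSum_pos hTE hbm hKb (by
    filter_upwards [hE] with x hx
    simpa using hx.1 0)
  have h2 := integral_nonneg_of_exists_birkhoffSum_pos hTE ham hKa (by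
    filter_upwards [hE] with x hx
    simpa using hx.2 0)
  have hfi : Integrable f (μ.restrict E) := .of_bound hf.aestronglyMeasurable K (.of_forall hK)
  rw [integral_sub hfi (integrable_const _), integral_const, smul_eq_mul] at h1
  rw [integral_sub (integrable_const _) hfi, integral_const, smul_eq_mul] at h2
  -- Adding the two inequalities cancels the integral of `f`.
  have h3 : (μ.restrict E).real Set.univ * (b - a) ≤ 0 := by linarith
  have h4 : (μ.restrict E).real Set.univ ≤ 0 := by
    by_contra h
    nlinarith
  have h5 : (μ.restrict E).real Set.univ = 0 := le_antisymm h4 measureReal_nonneg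
  rw [measureReal_restrict_apply_univ, measureReal_eq_zero_iff] at h5
  exact h5

/-- **Birkhoff's pointwise ergodic theorem** for bounded functions: the averages converge almost
everywhere. -/
theorem ae_exists_tendsto_birkhoffAverage {μ : Measure X} [IsFiniteMeasure μ] {T : X → X}
    (hT : MeasurePreserving T μ μ) {f : X → ℝ} (hf : Measurable f) {K : ℝ}
    (hK : ∀ x, |f x| ≤ K) :
    ∀ᵐ x ∂μ, ∃ l : ℝ, Tendsto (fun n => birkhoffAverage ℝ T f n x) atTop (𝓝 l) := by
  have hae : ∀ᵐ x ∂μ, ∀ a b : ℚ, (a : ℝ) < b →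
      x ∉ birkhoffUnbounded T (fun x => f x - b) ∩ birkhoffUnbounded T (fun x => a - f x) := by
    rw [ae_all_iff]; intro a
    rw [ae_all_iff]; intro b
    by_cases hab : (a : ℝ) < b
    · filter_upwards [measure_eq_zero_iff_ae_notMem.1
        (measure_birkhoffUnbounded_inter_eq_zero hT hf hK hab)] with x hx _ using hx
    · exact .of_forall fun x h => absurd h hab
  filter_upwards [hae] with x hx
  have hbd (n : ℕ) : |birkhoffAverage ℝ T f n x| ≤ K := by
    have hK0 : 0 ≤ K := (abs_nonneg _).trans (hK x)
    rcases Nat.eq_zero_or_pos n with rfl | hn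
    · simpa using hK0
    · have hn' : (0 : ℝ) < n := by exact_mod_cast hn
      rw [birkhoffAverage, smul_eq_mul, abs_mul, abs_inv, Nat.abs_cast, inv_mul_le_iff₀ hn',
        birkhoffSum]
      calc |∑ k ∈ Finset.range n, f (T^[k] x)| ≤ ∑ k ∈ Finset.range n, |f (T^[k] x)| :=
            Finset.abs_sum_le_sum_abs _ _
        _ ≤ ∑ _k ∈ Finset.range n, K := Finset.sum_le_sum fun k _ => hK _
        _ = n * K := by simp
  have hsum (n : ℕ) : birkhoffSum T f n x = n * birkhoffAverage ℝ T f n x := by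
    rcases Nat.eq_zero_or_pos n with rfl | hn
    · simp
    · have hn' : (n : ℝ) ≠ 0 := by exact_mod_cast hn.ne'
      rw [birkhoffAverage, smul_eq_mul, mul_inv_cancel_left₀ hn']
  have hsub (c : ℝ) (n : ℕ) :
      birkhoffSum T (fun x => f x - c) n x = n * (birkhoffAverage ℝ T f n x - c) := by
    rw [mul_sub, ← hsum]; simp [birkhoffSum]
  have hsub' (c : ℝ) (n : ℕ) :
      birkhoffSum T (fun x => c - f x) n x = n * (c - birkhoffAverage ℝ T f n x) := by
    rw [mul_sub, ← hsum]; simp [birkhoffSum]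
  -- A bounded sequence converges unless it oscillates infinitely often across some interval with
  -- rational ends. The smaller interval from `a'` to `b'` leaves gaps `a' - a` and `b - b'`, which
  -- turn the oscillation of averages into linear growth of the two kinds of sums.
  refine tendsto_of_no_upcrossings (s := Set.range ((↑) : ℚ → ℝ)) Rat.denseRange_cast ?_
    (isBoundedUnder_of ⟨K, fun n => (abs_le.1 (hbd n)).2⟩)
    (isBoundedUnder_of ⟨-K, fun n => (abs_le.1 (hbd n)).1⟩)
  rintro _ ⟨a, rfl⟩ _ ⟨b, rfl⟩ hab ⟨ha, hb⟩
  obtain ⟨a', haa', ha'b⟩ := exists_rat_btwn hab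
  obtain ⟨b', hab', hb'b⟩ := exists_rat_btwn ha'b
  refine hx a' b' hab' ⟨mem_birkhoffUnbounded_of_frequently (sub_pos.2 hb'b) ?_,
    mem_birkhoffUnbounded_of_frequently (sub_pos.2 haa') ?_⟩
  · refine hb.mono fun n hn => ?_
    rw [hsub]
    exact mul_le_mul_of_nonneg_left (by linarith) n.cast_nonneg
  · refine ha.mono fun n hn => ?_
    rw [hsub']
    exact mul_le_mul_of_nonneg_left (by linarith) n.cast_nonneg

end BirkhoffTheorem

/-! ### Comparison of exponential growth rates -/

section GrowthRates

/-- Sequences that agree up to bounded factors have the same exponential growth rate. -/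
lemma tendsto_log_div_of_comparable {x y : ℕ → ℝ} {K l : ℝ} (hx : ∀ n, 0 < x n)
    (hy : ∀ n, 0 < y n) (hxy : ∀ n, x n ≤ K * y n) (hyx : ∀ n, y n ≤ K * x n)
    (h : Tendsto (fun n : ℕ => 1 / (n : ℝ) * Real.log (x n)) atTop (𝓝 l)) :
    Tendsto (fun n : ℕ => 1 / (n : ℝ) * Real.log (y n)) atTop (𝓝 l) := by
  have hK : 0 < K := pos_of_mul_pos_left ((hx 0).trans_le (hxy 0)) (hy 0).le
  have hd (n : ℕ) : |Real.log (y n) - Real.log (x n)| ≤ Real.log K := by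
    have h1 := Real.log_le_log (hx n) (hxy n)
    have h2 := Real.log_le_log (hy n) (hyx n)
    rw [Real.log_mul hK.ne' (hy n).ne'] at h1
    rw [Real.log_mul hK.ne' (hx n).ne'] at h2
    exact abs_le.2 ⟨by linarith, by linarith⟩
  have h0 : Tendsto (fun n : ℕ => 1 / (n : ℝ) * (Real.log (y n) - Real.log (x n))) atTop (𝓝 0) :=
    tendsto_one_div_atTop_nhds_zero_nat.zero_mul_isBoundedUnder_le
      (isBoundedUnder_of ⟨Real.log K, fun n => by simpa using hd n⟩)
  have := h.add h0
  rw [add_zero] at this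
  exact this.congr fun n => by ring

/-- A sequence that is bounded below and grows at most linearly has growth rate `0`. -/
lemma tendsto_log_div_of_linear_bound {x : ℕ → ℝ} {c C : ℝ} (hc : 0 < c) (hcx : ∀ n, c ≤ x n)
    (hxC : ∀ n, x n ≤ C * (n + 1)) :
    Tendsto (fun n : ℕ => 1 / (n : ℝ) * Real.log (x n)) atTop (𝓝 0) := by
  have hC : 0 < C := by
    have := (hcx 0).trans (hxC 0)
    simp only [Nat.cast_zero, zero_add, mul_one] at this
    linarith
  have hlow : Tendsto (fun n : ℕ => 1 / (n : ℝ) * Real.log c) atTop (𝓝 0) := by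
    simpa using tendsto_one_div_atTop_nhds_zero_nat.mul_const (Real.log c)
  have hlog : Tendsto (fun n : ℕ => Real.log (n : ℝ) / (n : ℝ)) atTop (𝓝 0) :=
    (Real.isLittleO_log_id_atTop.tendsto_div_nhds_zero).comp tendsto_natCast_atTop_atTop
  have hup : Tendsto (fun n : ℕ => 1 / (n : ℝ) * Real.log (2 * C) + Real.log (n : ℝ) / (n : ℝ))
      atTop (𝓝 0) := by
    simpa using (tendsto_one_div_atTop_nhds_zero_nat.mul_const (Real.log (2 * C))).add hlog
  refine tendsto_of_tendsto_of_tendsto_of_le_of_le' hlow hup ?_ ?_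
  · exact .of_forall fun n => mul_le_mul_of_nonneg_left (Real.log_le_log hc (hcx n)) (by positivity)
  · filter_upwards [eventually_ge_atTop 1] with n hn
    have hn' : (1 : ℝ) ≤ n := by exact_mod_cast hn
    have h1 : x n ≤ 2 * C * n := (hxC n).trans (by nlinarith)
    have h2 := Real.log_le_log (hc.trans_le (hcx n)) h1
    rw [Real.log_mul (by positivity) (by positivity)] at h2
    calc 1 / (n : ℝ) * Real.log (x n)
        ≤ 1 / (n : ℝ) * (Real.log (2 * C) + Real.log n) :=
          mul_le_mul_of_nonneg_left h2 (by positivity)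
      _ = _ := by ring

end GrowthRates

/-! ### Area and growth of vectors in the plane -/

section Plane

/-- The standard area form of the plane. -/
def areaForm (v w : Tangent) : ℝ := v 0 * w 1 - v 1 * w 0

lemma abs_coord_le_norm (v : Tangent) (i : Fin 2) : |v i| ≤ ‖v‖ := by
  simpa using PiLp.norm_apply_le v i

lemma norm_le_abs_add_abs (v : Tangent) : ‖v‖ ≤ |v 0| + |v 1| := by
  rw [EuclideanSpace.norm_eq, Fin.sum_univ_two, Real.norm_eq_abs, Real.norm_eq_abs]
  refine Real.sqrt_le_iff.2 ⟨by positivity, ?_⟩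
  nlinarith [abs_nonneg (v 0), abs_nonneg (v 1)]

lemma abs_areaForm_le (v w : Tangent) : |areaForm v w| ≤ 2 * ‖v‖ * ‖w‖ := by
  have h1 : |v 0 * w 1| ≤ ‖v‖ * ‖w‖ := by
    rw [abs_mul]
    exact mul_le_mul (abs_coord_le_norm v 0) (abs_coord_le_norm w 1) (abs_nonneg _) (norm_nonneg _)
  have h2 : |v 1 * w 0| ≤ ‖v‖ * ‖w‖ := by
    rw [abs_mul]
    exact mul_le_mul (abs_coord_le_norm v 1) (abs_coord_le_norm w 0) (abs_nonneg _) (norm_nonneg _)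
  have h3 := abs_sub (v 0 * w 1) (v 1 * w 0)
  rw [areaForm]
  linarith

/-- Cramer's rule. -/
lemma exists_eq_smul_add_smul {u s : Tangent} (hus : areaForm u s ≠ 0) (v : Tangent) :
    ∃ a b : ℝ, v = a • u + b • s := by
  refine ⟨areaForm v s / areaForm u s, areaForm u v / areaForm u s, ?_⟩
  ext i
  simp only [PiLp.add_apply, PiLp.smul_apply, smul_eq_mul]
  field_simp
  fin_cases i <;> simp only [areaForm, Fin.zero_eta, Fin.mk_one] <;> ring

/-- If area-preserving linear maps have growth rates along two transversal directions, along one of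
which they are bounded, then they have growth rates along all directions. -/
lemma exists_tendsto_log_norm_of_transversal {B : ℕ → Tangent →L[ℝ] Tangent}
    (hB : ∀ n v w, areaForm (B n v) (B n w) = areaForm v w) {u s : Tangent}
    (hus : areaForm u s ≠ 0) {C : ℝ} (hC : ∀ n, ‖B n s‖ ≤ C)
    (hu : ∃ l : ℝ, Tendsto (fun n : ℕ => 1 / (n : ℝ) * Real.log ‖B n u‖) atTop (𝓝 l))
    (hs : ∃ l : ℝ, Tendsto (fun n : ℕ => 1 / (n : ℝ) * Real.log ‖B n s‖) atTop (𝓝 l))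
    {v : Tangent} (hv : v ≠ 0) :
    ∃ l : ℝ, Tendsto (fun n : ℕ => 1 / (n : ℝ) * Real.log ‖B n v‖) atTop (𝓝 l) := by
  have hspos (n : ℕ) : 0 < ‖B n s‖ := by
    refine norm_pos_iff.2 fun h => hus ?_
    rw [← hB n, h]; simp [areaForm]
  have hCpos : 0 < C := (hspos 0).trans_le (hC 0)
  -- The area spanned with `s` is preserved while the image of `s` stays bounded, so the image of a
  -- vector transversal to `s` cannot become short.
  have hlow (w : Tangent) (n : ℕ) : |areaForm w s| / (2 * C) ≤ ‖B n w‖ := by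
    rw [div_le_iff₀ (by positivity), ← hB n]
    have h1 := abs_areaForm_le (B n w) (B n s)
    have h2 := mul_le_mul_of_nonneg_left (hC n) (norm_nonneg (B n w))
    linarith
  obtain ⟨a, b, hab⟩ := exists_eq_smul_add_smul hus v
  have hBv (n : ℕ) : B n v = a • B n u + b • B n s := by rw [hab]; simp
  by_cases ha : a = 0
  · have hb : b ≠ 0 := by
      rintro rfl
      exact hv (by simp [hab, ha])
    have hb' : 0 < |b| := abs_pos.2 hb
    obtain ⟨l, hl⟩ := hs
    have hn (n : ℕ) : ‖B n v‖ = |b| * ‖B n s‖ := by rw [hBv, ha]; simp [norm_smul]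
    refine ⟨l, tendsto_log_div_of_comparable (K := |b| + |b|⁻¹) hspos
      (fun n => by rw [hn]; exact mul_pos hb' (hspos n)) (fun n => ?_) (fun n => ?_) hl⟩
    · rw [hn]
      have : (|b| + |b|⁻¹) * (|b| * ‖B n s‖) = |b| * |b| * ‖B n s‖ + ‖B n s‖ := by field_simp
      rw [this]
      linarith [mul_nonneg (mul_nonneg hb'.le hb'.le) (hspos n).le]
    · rw [hn]
      exact mul_le_mul_of_nonneg_right (by linarith [inv_pos.2 hb']) (hspos n).le
  · have ha' : 0 < |a| := abs_pos.2 ha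
    have hvs : areaForm v s = a * areaForm u s := by
      rw [hab]; simp only [areaForm, PiLp.add_apply, PiLp.smul_apply, smul_eq_mul]; ring
    set cu := |areaForm u s| / (2 * C) with hcu
    set cv := |areaForm v s| / (2 * C) with hcv
    have hcu0 : 0 < cu := div_pos (abs_pos.2 hus) (by positivity)
    have hcv0 : 0 < cv := div_pos (abs_pos.2 (hvs ▸ mul_ne_zero ha hus)) (by positivity)
    obtain ⟨l, hl⟩ := hu
    have hbound {c x : ℝ} (hc : 0 < c) (hx : c ≤ x) : |b| * C ≤ |b| * C / c * x := by
      rw [div_mul_eq_mul_div, le_div_iff₀ hc]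
      exact mul_le_mul_of_nonneg_left hx (by positivity)
    have hbs (n : ℕ) : ‖b • B n s‖ ≤ |b| * C := by
      rw [norm_smul, Real.norm_eq_abs]
      exact mul_le_mul_of_nonneg_left (hC n) (abs_nonneg _)
    -- The component along `s` contributes at most `|b| * C`, which `hlow` absorbs into a multiple
    -- of `‖B n u‖` or of `‖B n v‖`. The constant is the sum of those needed for the two
    -- inequalities.
    refine ⟨l, tendsto_log_div_of_comparable
      (K := (1 + |b| * C / cv) / |a| + (|a| + |b| * C / cu))
      (fun n => hcu0.trans_le (hlow u n)) (fun n => hcv0.trans_le (hlow v n))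
      (fun n => ?_) (fun n => ?_) hl⟩
    · have h1 : |a| * ‖B n u‖ ≤ (1 + |b| * C / cv) * ‖B n v‖ := by
        have : a • B n u = B n v - b • B n s := by rw [hBv]; abel
        rw [← Real.norm_eq_abs, ← norm_smul, this]
        refine (norm_sub_le _ _).trans ?_
        linarith [hbs n, hbound hcv0 (hlow v n)]
      have h2 : ‖B n u‖ ≤ (1 + |b| * C / cv) / |a| * ‖B n v‖ := by
        rw [div_mul_eq_mul_div, le_div_iff₀ ha']; linarith
      have h3 : 0 ≤ (|a| + |b| * C / cu) * ‖B n v‖ := by positivity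
      linarith
    · have h1 : ‖B n v‖ ≤ (|a| + |b| * C / cu) * ‖B n u‖ := by
        rw [hBv]
        refine (norm_add_le _ _).trans ?_
        rw [norm_smul, Real.norm_eq_abs]
        linarith [hbs n, hbound hcu0 (hlow u n)]
      have h3 : 0 ≤ (1 + |b| * C / cv) / |a| * ‖B n u‖ := by positivity
      linarith

/-- A non-zero vector moved by bounded shears along one axis has growth rate `0`. -/
lemma tendsto_log_norm_of_shears {w : ℕ → Tangent} {i j : Fin 2} (hij : i ≠ j) {a : ℕ → ℝ} {K : ℝ}
    (ha : ∀ n, |a n| ≤ K) (hj : ∀ n, w (n + 1) j = w n j)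
    (hi : ∀ n, w (n + 1) i = w n i + a n * w n j) (h0 : w 0 ≠ 0) :
    Tendsto (fun n : ℕ => 1 / (n : ℝ) * Real.log ‖w n‖) atTop (𝓝 0) := by
  have hK : 0 ≤ K := (abs_nonneg _).trans (ha 0)
  have hjn (n : ℕ) : w n j = w 0 j := by
    induction n with
    | zero => rfl
    | succ n ih => rw [hj, ih]
  have hin (n : ℕ) : |w n i| ≤ |w 0 i| + n * (K * |w 0 j|) := by
    induction n with
    | zero => simp
    | succ n ih =>
      rw [hi, hjn]
      refine (abs_add_le _ _).trans ?_
      rw [abs_mul]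
      have := mul_le_mul_of_nonneg_right (ha n) (abs_nonneg (w 0 j))
      push_cast
      linarith
  have hnorm (v : Tangent) : ‖v‖ ≤ |v i| + |v j| := by
    have := norm_le_abs_add_abs v
    fin_cases i <;> fin_cases j <;> (simp_all; try linarith)
  have hup (n : ℕ) : ‖w n‖ ≤ (|w 0 i| + |w 0 j| + K * |w 0 j|) * (n + 1) := by
    have h1 := hnorm (w n)
    have h2 := hin n
    rw [hjn] at h1
    have h3 : 0 ≤ (n : ℝ) * (|w 0 i| + |w 0 j|) := by positivity
    have h4 : 0 ≤ K * |w 0 j| := by positivity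
    linarith
  -- The coordinate `j` never changes, so it bounds the norm from below unless it vanishes, in which
  -- case the shears fix the vector.
  by_cases hz : w 0 j = 0
  · have hin' (n : ℕ) : w n i = w 0 i := by
      induction n with
      | zero => rfl
      | succ n ih => rw [hi, ih, hjn, hz, mul_zero, add_zero]
    have : 0 < |w 0 i| := by
      have h1 := (norm_pos_iff.2 h0).trans_le (hnorm (w 0))
      simpa [hz] using h1
    exact tendsto_log_div_of_linear_bound this
      (fun n => by rw [← hin' n]; exact abs_coord_le_norm _ _) hup
  · exact tendsto_log_div_of_linear_bound (abs_pos.2 hz)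
      (fun n => by rw [← hjn n]; exact abs_coord_le_norm _ _) hup

end Plane

/-! ### Linear cocycles with invariant sections -/

section Cocycle

variable {X : Type*}

/-- The product of the linear maps `D` along the first `n` points of the orbit of `x`. -/
noncomputable def cocycle (φ : X → X) (D : X → Tangent →L[ℝ] Tangent) :
    ℕ → X → Tangent →L[ℝ] Tangent
  | 0, _ => .id ℝ Tangent
  | n + 1, x => (D (φ^[n] x)).comp (cocycle φ D n x)

variable {φ : X → X} {D : X → Tangent →L[ℝ] Tangent}

lemma cocycle_apply_section {e : X → Tangent} {r : X → ℝ} (hr : ∀ x, 0 < r x)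
    (he : ∀ x, D x (e x) = r x • e (φ x)) (n : ℕ) (x : X) :
    cocycle φ D n x (e x) =
      Real.exp (birkhoffSum φ (fun y => Real.log (r y)) n x) • e (φ^[n] x) := by
  induction n with
  | zero => simp [cocycle]
  | succ n ih =>
    rw [cocycle, ContinuousLinearMap.comp_apply, ih, map_smul, he, smul_smul, birkhoffSum_succ,
      Real.exp_add, Real.exp_log (hr _), Function.iterate_succ_apply']

lemma areaForm_cocycle (hD : ∀ x v w, areaForm (D x v) (D x w) = areaForm v w) (n : ℕ) (x : X)
    (v w : Tangent) : areaForm (cocycle φ D n x v) (cocycle φ D n x w) = areaForm v w := by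
  induction n with
  | zero => rfl
  | succ n ih =>
    rw [cocycle, ContinuousLinearMap.comp_apply, ContinuousLinearMap.comp_apply, hD, ih]

/-- The section has norm between `K⁻¹` and `K`, so the norm of its image differs from the
exponential of the Birkhoff sum of `log r` by a bounded factor. -/
lemma tendsto_log_norm_cocycle_section {e : X → Tangent} {r : X → ℝ} (hr : ∀ x, 0 < r x)
    (he : ∀ x, D x (e x) = r x • e (φ x)) {K : ℝ} (hK : 0 < K) (he1 : ∀ x, 1 ≤ K * ‖e x‖)
    (he2 : ∀ x, ‖e x‖ ≤ K) {x : X} {l : ℝ}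
    (hl : Tendsto (fun n => birkhoffAverage ℝ φ (fun y => Real.log (r y)) n x) atTop (𝓝 l)) :
    Tendsto (fun n : ℕ => 1 / (n : ℝ) * Real.log ‖cocycle φ D n x (e x)‖) atTop (𝓝 l) := by
  have hpos (y : X) : 0 < ‖e y‖ := pos_of_mul_pos_right (one_pos.trans_le (he1 y)) hK.le
  have hn (n : ℕ) : ‖cocycle φ D n x (e x)‖ =
      Real.exp (birkhoffSum φ (fun y => Real.log (r y)) n x) * ‖e (φ^[n] x)‖ := by
    rw [cocycle_apply_section hr he, norm_smul, Real.norm_of_nonneg (Real.exp_nonneg _)]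
  refine tendsto_log_div_of_comparable (K := K)
    (x := fun n => Real.exp (birkhoffSum φ (fun y => Real.log (r y)) n x))
    (fun n => Real.exp_pos _) (fun n => ?_) (fun n => ?_) (fun n => ?_) ?_
  · rw [hn]; exact mul_pos (Real.exp_pos _) (hpos _)
  · rw [hn, mul_left_comm]
    exact le_mul_of_one_le_right (Real.exp_nonneg _) (he1 _)
  · rw [hn, mul_comm K]
    exact mul_le_mul_of_nonneg_left (he2 _) (Real.exp_nonneg _)
  · refine hl.congr fun n => ?_
    rw [Real.log_exp, birkhoffAverage, smul_eq_mul, one_div]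

/-- An area-preserving cocycle with an invariant section and a transversal contracted invariant
section, along both of which the growth rates exist, has growth rates along all directions. -/
lemma exists_tendsto_log_norm_cocycle (hD : ∀ x v w, areaForm (D x v) (D x w) = areaForm v w)
    {e f : X → Tangent} {r q : X → ℝ} (hr : ∀ x, 0 < r x) (hq : ∀ x, 0 < q x) (hq1 : ∀ x, q x ≤ 1)
    (he : ∀ x, D x (e x) = r x • e (φ x)) (hf : ∀ x, D x (f x) = q x • f (φ x))
    {K : ℝ} (hK : 0 < K) (he1 : ∀ x, 1 ≤ K * ‖e x‖) (he2 : ∀ x, ‖e x‖ ≤ K)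
    (hf1 : ∀ x, 1 ≤ K * ‖f x‖) (hf2 : ∀ x, ‖f x‖ ≤ K) {x : X} (hx : areaForm (e x) (f x) ≠ 0)
    (hlr : ∃ l : ℝ, Tendsto (fun n => birkhoffAverage ℝ φ (fun y => Real.log (r y)) n x)
      atTop (𝓝 l))
    (hlq : ∃ l : ℝ, Tendsto (fun n => birkhoffAverage ℝ φ (fun y => Real.log (q y)) n x)
      atTop (𝓝 l)) {v : Tangent} (hv : v ≠ 0) :
    ∃ l : ℝ, Tendsto (fun n : ℕ => 1 / (n : ℝ) * Real.log ‖cocycle φ D n x v‖) atTop (𝓝 l) := by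
  obtain ⟨l, hl⟩ := hlr
  obtain ⟨l', hl'⟩ := hlq
  refine exists_tendsto_log_norm_of_transversal (B := fun n => cocycle φ D n x)
    (fun n => areaForm_cocycle hD n x) hx (C := K) (fun n => ?_)
    ⟨l, tendsto_log_norm_cocycle_section hr he hK he1 he2 hl⟩
    ⟨l', tendsto_log_norm_cocycle_section hq hf hK hf1 hf2 hl'⟩ hv
  rw [cocycle_apply_section hq hf, norm_smul, Real.norm_of_nonneg (Real.exp_nonneg _)]
  have h1 : Real.exp (birkhoffSum φ (fun y => Real.log (q y)) n x) ≤ 1 :=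
    Real.exp_le_one_iff.2 (Finset.sum_nonpos fun k _ => Real.log_nonpos (hq _).le (hq1 _))
  exact (mul_le_of_le_one_left (norm_nonneg _) h1).trans (hf2 _)

end Cocycle

/-! ### Invariant directions for non-negative unimodular matrices -/

section InvariantSection

/-- The matrix `(a b; c d)` has determinant one, non-negative entries and diagonal at least one. -/
structure IsPositiveUnimodular (a b c d : ℝ) : Prop where
  one_le_a : 1 ≤ a
  b_nonneg : 0 ≤ b
  c_nonneg : 0 ≤ c
  one_le_d : 1 ≤ d
  det_eq_one : a * d - b * c = 1

/-- The factor by which the matrix `(a b; c d)` stretches the vector `(1 - s, s)` in the `ℓ¹`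
norm. -/
def stretch (a b c d s : ℝ) : ℝ := (a + c) * (1 - s) + (b + d) * s

/-- The action of the matrix `(a b; c d)` on directions in the first quadrant, in the coordinate
`s` that parametrizes the direction of `(1 - s, s)`. -/
noncomputable def directionMap (a b c d s : ℝ) : ℝ :=
  (c * (1 - s) + d * s) / stretch a b c d s

variable {a b c d s t : ℝ}

lemma one_le_stretch (h : IsPositiveUnimodular a b c d) (hs : s ∈ Set.Icc (0 : ℝ) 1) :
    1 ≤ stretch a b c d s := by
  have h1 : 1 * (1 - s) ≤ (a + c) * (1 - s) :=
    mul_le_mul_of_nonneg_right (by linarith [h.one_le_a, h.c_nonneg]) (by linarith [hs.2])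
  have h2 : 1 * s ≤ (b + d) * s :=
    mul_le_mul_of_nonneg_right (by linarith [h.one_le_d, h.b_nonneg]) hs.1
  rw [stretch]
  linarith

lemma stretch_le (h : IsPositiveUnimodular a b c d) (hs : s ∈ Set.Icc (0 : ℝ) 1) :
    stretch a b c d s ≤ a + b + c + d := by
  have h1 : (a + c) * (1 - s) ≤ a + c :=
    mul_le_of_le_one_right (by linarith [h.one_le_a, h.c_nonneg]) (by linarith [hs.1])
  have h2 : (b + d) * s ≤ b + d :=
    mul_le_of_le_one_right (by linarith [h.one_le_d, h.b_nonneg]) hs.2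
  rw [stretch]
  linarith

lemma directionMap_mem_Icc (h : IsPositiveUnimodular a b c d) (hs : s ∈ Set.Icc (0 : ℝ) 1) :
    directionMap a b c d s ∈ Set.Icc (0 : ℝ) 1 := by
  have h0 := one_le_stretch h hs
  have h1 : 0 ≤ a * (1 - s) := mul_nonneg (by linarith [h.one_le_a]) (by linarith [hs.2])
  have h2 : 0 ≤ b * s := mul_nonneg h.b_nonneg hs.1
  have h3 : 0 ≤ c * (1 - s) := mul_nonneg h.c_nonneg (by linarith [hs.2])
  have h4 : 0 ≤ d * s := mul_nonneg (by linarith [h.one_le_d]) hs.1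
  refine ⟨div_nonneg (by linarith) (by linarith), (div_le_one (by linarith)).2 ?_⟩
  rw [stretch]
  linarith

/-- After cross-multiplication the difference is the determinant times `t - s`: a Möbius map of
determinant one is increasing. -/
lemma directionMap_le (h : IsPositiveUnimodular a b c d) (hs : s ∈ Set.Icc (0 : ℝ) 1)
    (ht : t ∈ Set.Icc (0 : ℝ) 1) (hst : s ≤ t) :
    directionMap a b c d s ≤ directionMap a b c d t := by
  have h1 := one_le_stretch h hs
  have h2 := one_le_stretch h ht
  rw [directionMap, directionMap, div_le_div_iff₀ (by linarith) (by linarith)]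
  have : (c * (1 - t) + d * t) * stretch a b c d s - (c * (1 - s) + d * s) * stretch a b c d t
      = (a * d - b * c) * (t - s) := by
    rw [stretch, stretch]; ring
  rw [h.det_eq_one] at this
  linarith

lemma stretch_mul_directionMap (h : IsPositiveUnimodular a b c d) (hs : s ∈ Set.Icc (0 : ℝ) 1) :
    stretch a b c d s * directionMap a b c d s = c * (1 - s) + d * s :=
  mul_div_cancel₀ _ (by linarith [one_le_stretch h hs])

lemma continuousAt_directionMap (h : IsPositiveUnimodular a b c d)
    (hs : s ∈ Set.Icc (0 : ℝ) 1) : ContinuousAt (directionMap a b c d) s := by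
  have h0 := one_le_stretch h hs
  unfold directionMap
  refine ContinuousAt.div (by fun_prop) ?_ (by linarith)
  unfold stretch
  fun_prop

variable {X : Type*} {a b c d : X → ℝ}

/-- The direction at `x` of the image of the first coordinate axis at `φ⁻ⁿ x`. -/
noncomputable def pastDirection (φ : Equiv.Perm X) (a b c d : X → ℝ) : ℕ → X → ℝ
  | 0, _ => 0
  | n + 1, x => directionMap (a (φ⁻¹ x)) (b (φ⁻¹ x)) (c (φ⁻¹ x)) (d (φ⁻¹ x))
      (pastDirection φ a b c d n (φ⁻¹ x))

lemma pastDirection_mem_Icc {φ : Equiv.Perm X}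
    (h : ∀ x, IsPositiveUnimodular (a x) (b x) (c x) (d x)) (n : ℕ) :
    ∀ x, pastDirection φ a b c d n x ∈ Set.Icc (0 : ℝ) 1 := by
  induction n with
  | zero => intro x; exact ⟨le_rfl, zero_le_one⟩
  | succ n ih => intro x; exact directionMap_mem_Icc (h _) (ih _)

/-- The iteration starts at `0`, the least direction, so its first step can only go up; monotonicity
of the direction maps propagates this. -/
lemma pastDirection_le_succ {φ : Equiv.Perm X}
    (h : ∀ x, IsPositiveUnimodular (a x) (b x) (c x) (d x)) (n : ℕ) :
    ∀ x, pastDirection φ a b c d n x ≤ pastDirection φ a b c d (n + 1) x := by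
  induction n with
  | zero => intro x; exact (pastDirection_mem_Icc h 1 x).1
  | succ n ih =>
    intro x
    exact directionMap_le (h _) (pastDirection_mem_Icc h _ _) (pastDirection_mem_Icc h _ _) (ih _)

/-- A cocycle of non-negative unimodular matrices over an invertible map has a measurable invariant
field of directions `(1 - s, s)` in the first quadrant. -/
theorem exists_measurable_invariant_direction [MeasurableSpace X] {φ : Equiv.Perm X}
    (hφ : Measurable (φ⁻¹ : Equiv.Perm X)) (ha : Measurable a)
    (hb : Measurable b) (hc : Measurable c) (hd : Measurable d)
    (h : ∀ x, IsPositiveUnimodular (a x) (b x) (c x) (d x)) :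
    ∃ s r : X → ℝ, Measurable r ∧ (∀ x, s x ∈ Set.Icc (0 : ℝ) 1) ∧
      (∀ x, 1 ≤ r x ∧ r x ≤ a x + b x + c x + d x) ∧
      (∀ x, a x * (1 - s x) + b x * s x = r x * (1 - s (φ x))) ∧
      ∀ x, c x * (1 - s x) + d x * s x = r x * s (φ x) := by
  have hmem := pastDirection_mem_Icc (φ := φ) h
  have hlim (x : X) : Tendsto (fun n => pastDirection φ a b c d n x) atTop
      (𝓝 (⨆ n, pastDirection φ a b c d n x)) :=
    tendsto_atTop_ciSup (monotone_nat_of_le_succ fun n => pastDirection_le_succ h n x)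
      ⟨1, by rintro _ ⟨n, rfl⟩; exact (hmem n x).2⟩
  set s : X → ℝ := fun x => ⨆ n, pastDirection φ a b c d n x with hs
  have hsm : Measurable s := by
    refine measurable_of_tendsto_metrizable (f := pastDirection φ a b c d) (fun n => ?_)
      (tendsto_pi_nhds.2 hlim)
    induction n with
    | zero => exact measurable_const
    | succ n ih =>
      have hn := ih.comp hφ
      have ha' := ha.comp hφ
      have hb' := hb.comp hφ
      have hc' := hc.comp hφ
      have hd' := hd.comp hφ
      exact ((hc'.mul (measurable_const.sub hn)).add (hd'.mul hn)).div
        (((ha'.add hc').mul (measurable_const.sub hn)).add ((hb'.add hd').mul hn))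
  have hsI (x : X) : s x ∈ Set.Icc (0 : ℝ) 1 :=
    isClosed_Icc.mem_of_tendsto (hlim x) (.of_forall fun n => hmem n x)
  -- Lengthening the past by one step at `φ x` applies the direction map at `x`; continuity lets the
  -- limit pass through it.
  have hinv (x : X) : s (φ x) = directionMap (a x) (b x) (c x) (d x) (s x) := by
    refine tendsto_nhds_unique ((tendsto_add_atTop_iff_nat 1).2 (hlim (φ x))) ?_
    refine ((continuousAt_directionMap (h x) (hsI x)).tendsto.comp (hlim x)).congr fun n => ?_
    simp [pastDirection]
  refine ⟨s, fun x => stretch (a x) (b x) (c x) (d x) (s x), ?_, hsI, fun x =>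
    ⟨one_le_stretch (h x) (hsI x), stretch_le (h x) (hsI x)⟩, fun x => ?_, fun x => ?_⟩
  · exact ((ha.add hc).mul (measurable_const.sub hsm)).add ((hb.add hd).mul hsm)
  · have := stretch_mul_directionMap (h x) (hsI x)
    rw [hinv]
    simp only [stretch] at this ⊢
    linarith
  · rw [hinv, stretch_mul_directionMap (h x) (hsI x)]

end InvariantSection

/-! ### Locally linear torus maps and their derivatives -/

section LocallyAffine

variable {L : ℝ}

/-- In the exponential charts centred at `z` and `φ z`, the map `φ` is the linear map `A` near
the origin. -/
def IsLocallyLinearAt (φ : Torus L → Torus L) (z : Torus L) (A : Tangent →L[ℝ] Tangent) : Prop :=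
  ∀ᶠ h in 𝓝 (0 : Tangent), φ (torusExp z h) = torusExp (φ z) (A h)

lemma isLocallyLinearAt_id (z : Torus L) : IsLocallyLinearAt id z (.id ℝ Tangent) :=
  .of_forall fun _ => rfl

lemma IsLocallyLinearAt.comp {φ ψ : Torus L → Torus L} {z : Torus L}
    {A B : Tangent →L[ℝ] Tangent} (hψ : IsLocallyLinearAt ψ (φ z) B)
    (hφ : IsLocallyLinearAt φ z A) : IsLocallyLinearAt (ψ ∘ φ) z (B.comp A) := by
  have hA : Tendsto A (𝓝 0) (𝓝 0) := by simpa using A.continuous.tendsto 0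
  filter_upwards [hφ, hA.eventually hψ] with h h1 h2
  rw [Function.comp_apply, h1, h2]
  rfl

lemma IsLocallyLinearAt.inv {φ : Equiv.Perm (Torus L)} {z : Torus L}
    {A B : Tangent →L[ℝ] Tangent} (hφ : IsLocallyLinearAt φ z A) (hAB : ∀ v, A (B v) = v) :
    IsLocallyLinearAt (φ⁻¹ : Equiv.Perm (Torus L)) (φ z) B := by
  have hB : Tendsto B (𝓝 0) (𝓝 0) := by simpa using B.continuous.tendsto 0
  filter_upwards [hB.eventually hφ] with h h1
  rw [hAB] at h1
  rw [← h1]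
  simp

lemma isLocallyLinearAt_iterate {φ : Torus L → Torus L} {D : Torus L → Tangent →L[ℝ] Tangent}
    {z : Torus L} (h : ∀ n, IsLocallyLinearAt φ (φ^[n] z) (D (φ^[n] z))) (n : ℕ) :
    IsLocallyLinearAt φ^[n] z (cocycle φ D n z) := by
  induction n with
  | zero => exact isLocallyLinearAt_id z
  | succ n ih =>
    rw [Function.iterate_succ']
    exact (h n).comp ih

variable [Fact (0 < L)]

lemma torusLog_coe {h : Tangent} (hh : ‖h‖ < L / 2) :
    torusLog ((h 0 : AddCircle L), (h 1 : AddCircle L)) = h := by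
  have hmem (i : Fin 2) : h i ∈ Set.Ico (-(L / 2)) (-(L / 2) + L) := by
    have := abs_lt.1 ((abs_coord_le_norm h i).trans_lt hh)
    exact ⟨by linarith, by linarith⟩
  ext i
  fin_cases i
  · simpa [torusLog] using AddCircle.equivIco_coe_of_mem (hmem 0)
  · simpa [torusLog] using AddCircle.equivIco_coe_of_mem (hmem 1)

/-- On the ball of radius `L / 2` the chosen logarithm inverts the exponential map at `0`, so the
local expression of `φ` equals `A` near the origin. -/
lemma IsLocallyLinearAt.hasFDerivAt {φ : Torus L → Torus L} {z : Torus L}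
    {A : Tangent →L[ℝ] Tangent} (h : IsLocallyLinearAt φ z A) :
    HasFDerivAt (torusLocal φ z) A 0 := by
  have hL : 0 < L / 2 := half_pos (Fact.out : 0 < L)
  have hA : Tendsto A (𝓝 0) (𝓝 0) := by simpa using A.continuous.tendsto 0
  refine A.hasFDerivAt.congr_of_eventuallyEq ?_
  filter_upwards [h, hA.eventually (Metric.ball_mem_nhds 0 hL)] with v h1 h2
  rw [torusLocal, h1]
  refine Eq.trans (congrArg torusLog ?_) (torusLog_coe (mem_ball_zero_iff.1 h2))
  simp [torusExp, Prod.ext_iff]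

end LocallyAffine

/-! ### Matrices acting on the plane -/

section PlaneMap

/-- The linear map of the plane with matrix `(a b; c d)`. -/
noncomputable def planeMap (a b c d : ℝ) : Tangent →L[ℝ] Tangent :=
  Matrix.toEuclideanCLM (n := Fin 2) (𝕜 := ℝ) !![a, b; c, d]

variable (a b c d : ℝ) (v : Tangent)

@[simp]
lemma planeMap_apply_zero : planeMap a b c d v 0 = a * v 0 + b * v 1 := by
  simp [planeMap, Matrix.mulVec, dotProduct, Fin.sum_univ_two]

@[simp]
lemma planeMap_apply_one : planeMap a b c d v 1 = c * v 0 + d * v 1 := by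
  simp [planeMap, Matrix.mulVec, dotProduct, Fin.sum_univ_two]

variable {a b c d}

lemma areaForm_planeMap (h : a * d - b * c = 1) (v w : Tangent) :
    areaForm (planeMap a b c d v) (planeMap a b c d w) = areaForm v w := by
  simp only [areaForm, planeMap_apply_zero, planeMap_apply_one]
  linear_combination (v 0 * w 1 - v 1 * w 0) * h

lemma tangent_ext {v w : Tangent} (h0 : v 0 = w 0) (h1 : v 1 = w 1) : v = w := by
  ext i
  fin_cases i
  exacts [h0, h1]

end PlaneMap

/-! ### The twist function and its slope -/

namespace TwistData

variable {L : ℝ} (T : TwistData L)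

lemma lo_lt_hi (i : Fin 2) : T.lo i < T.hi i := by
  fin_cases i
  exacts [T.lo_zero_lt_hi_zero, T.lo_one_lt_hi_one]

lemma finite_endpoints : T.endpoints.Finite := by
  refine ((Set.finite_range fun i => (T.lo i : AddCircle L)).union
    (Set.finite_range fun i => (T.hi i : AddCircle L))).subset ?_
  rintro y ⟨i, rfl | rfl⟩
  exacts [.inl ⟨i, rfl⟩, .inr ⟨i, rfl⟩]

lemma measurableSet_arcs : MeasurableSet T.arcs :=
  .iUnion fun _ => (isCompact_Icc.image (AddCircle.continuous_mk' L)).isClosed.measurableSet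

variable [Fact (0 < L)]

/-- The derivative of the twist supported on the `i`-th arc. -/
noncomputable def slopeOn (i : Fin 2) (y : AddCircle L) : ℝ :=
  if (AddCircle.equivIco L (T.lo i) y : ℝ) ≤ T.hi i then
    T.wrap i * L / (T.hi i - T.lo i) else 0

/-- The derivative of the twist function off the endpoints of the arcs. -/
noncomputable def slope (y : AddCircle L) : ℝ := ∑ i, T.slopeOn i y

/-- An upper bound for the derivative of the twist function. -/
noncomputable def slopeBound : ℝ := ∑ i, T.wrap i * L / (T.hi i - T.lo i)

lemma slope_term_nonneg (i : Fin 2) : 0 ≤ T.wrap i * L / (T.hi i - T.lo i) :=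
  div_nonneg (mul_nonneg (Nat.cast_nonneg _) (Fact.out : 0 < L).le) (sub_pos.2 (T.lo_lt_hi i)).le

lemma slope_nonneg (y : AddCircle L) : 0 ≤ T.slope y :=
  Finset.sum_nonneg fun i _ => by
    rw [slopeOn]
    split_ifs
    exacts [T.slope_term_nonneg i, le_rfl]

lemma slope_le (y : AddCircle L) : T.slope y ≤ T.slopeBound :=
  Finset.sum_le_sum fun i _ => by
    rw [slopeOn]
    split_ifs
    exacts [le_rfl, T.slope_term_nonneg i]

lemma measurable_coe_equivIco (a : ℝ) :
    Measurable fun y : AddCircle L => (AddCircle.equivIco L a y : ℝ) :=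
  measurable_subtype_coe.comp (AddCircle.measurableEquivIco L a).measurable

lemma measurable_slope : Measurable T.slope :=
  Finset.measurable_fun_sum _ fun _ _ => Measurable.ite
    (measurableSet_le (measurable_coe_equivIco _) measurable_const)
    measurable_const measurable_const

lemma measurable_twist : Measurable T.twist :=
  Finset.measurable_fun_sum _ fun _ _ => Measurable.ite
    (measurableSet_le (measurable_coe_equivIco _) measurable_const)
    (AddCircle.measurable_mk'.comp
      ((((measurable_coe_equivIco _).sub_const _).div_const _).const_mul _)) measurable_const

lemma twist_eq_zero {y : AddCircle L} (hy : y ∉ T.arcs) : T.twist y = 0 :=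
  Finset.sum_eq_zero fun i _ => by
    refine if_neg fun h => hy (Set.mem_iUnion.2 ⟨i, _, ⟨?_, h⟩, AddCircle.coe_equivIco⟩)
    exact (AddCircle.equivIco L (T.lo i) y).2.1

lemma eventually_twistOn_add {y : AddCircle L} (hy : y ∉ T.endpoints) (i : Fin 2) :
    ∀ᶠ h : ℝ in 𝓝 0,
      T.twistOn i (y + (h : AddCircle L)) = T.twistOn i y + ((T.slopeOn i y * h : ℝ) : AddCircle L)
    := by
  set t : ℝ := (AddCircle.equivIco L (T.lo i) y : ℝ) with ht
  have hty : (t : AddCircle L) = y := AddCircle.coe_equivIco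
  have htI : t ∈ Set.Ico (T.lo i) (T.lo i + L) := (AddCircle.equivIco L (T.lo i) y).2
  -- The representative jumps only at `lo i`, and the formula for the twist changes only at `hi i`.
  -- Both are endpoints, so near `y` the representative moves by `h` and a single affine branch
  -- applies.
  have hlo : T.lo i < t := lt_of_le_of_ne htI.1 fun h => hy ⟨i, .inl (by rw [← hty, ← h])⟩
  have hhi : t ≠ T.hi i := fun h => hy ⟨i, .inr (by rw [← hty, ← h])⟩
  have htend : Tendsto (fun h : ℝ => t + h) (𝓝 0) (𝓝 t) := by
    simpa using (continuous_const_add t).tendsto (0 : ℝ)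
  have hrep : ∀ᶠ h : ℝ in 𝓝 0,
      (AddCircle.equivIco L (T.lo i) (y + (h : AddCircle L)) : ℝ) = t + h := by
    filter_upwards [htend.eventually (Ioo_mem_nhds hlo htI.2)] with h hh
    rw [← hty, ← AddCircle.coe_add]
    exact AddCircle.equivIco_coe_of_mem ⟨hh.1.le, hh.2⟩
  have hlt := sub_pos.2 (T.lo_lt_hi i)
  rcases lt_or_gt_of_ne hhi with h | h
  · filter_upwards [hrep, htend.eventually (Iio_mem_nhds h)] with x hx hx'
    simp only [twistOn, slopeOn, hx]
    rw [if_pos (le_of_lt hx'), ← ht, if_pos h.le, if_pos h.le, ← AddCircle.coe_add]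
    congr 1
    field_simp
    ring
  · filter_upwards [hrep, htend.eventually (Ioi_mem_nhds h)] with x hx hx'
    simp only [twistOn, slopeOn, hx]
    rw [if_neg (not_le.2 hx'), ← ht, if_neg (not_le.2 h), if_neg (not_le.2 h)]
    simp

lemma eventually_twist_add {y : AddCircle L} (hy : y ∉ T.endpoints) :
    ∀ᶠ h : ℝ in 𝓝 0,
      T.twist (y + (h : AddCircle L)) = T.twist y + ((T.slope y * h : ℝ) : AddCircle L) := by
  filter_upwards [eventually_all.2 (T.eventually_twistOn_add hy)] with h hh
  simp only [twist, slope, Fin.sum_univ_two, hh, add_mul, AddCircle.coe_add]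
  abel

end TwistData

/-! ### Invariance, derivative and measure preservation of the linked-twist map -/

namespace LinkedTwist

variable {L : ℝ} (Λ : LinkedTwist L)

lemma measurableSet_R : MeasurableSet Λ.R :=
  (measurable_snd Λ.p.measurableSet_arcs).union (measurable_fst Λ.q.measurableSet_arcs)

variable [Fact (0 < L)]

/-- `F` keeps the second coordinate, hence preserves `P`, and it is the identity off `P`. -/
lemma F_mem_R_iff (z : Torus L) : Λ.F z ∈ Λ.R ↔ z ∈ Λ.R := by
  by_cases hz : z.2 ∈ Λ.p.arcs
  · exact iff_of_true (.inl hz) (.inl hz)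
  · have : Λ.F z = z := by simp [F, Λ.p.twist_eq_zero hz]
    rw [this]

lemma G_mem_R_iff (z : Torus L) : Λ.G z ∈ Λ.R ↔ z ∈ Λ.R := by
  by_cases hz : z.1 ∈ Λ.q.arcs
  · exact iff_of_true (.inr hz) (.inr hz)
  · have : Λ.G z = z := by simp [G, Λ.q.twist_eq_zero hz]
    rw [this]

lemma H_mem_R_iff (z : Torus L) : Λ.H z ∈ Λ.R ↔ z ∈ Λ.R :=
  (Λ.G_mem_R_iff _).trans (Λ.F_mem_R_iff z)

lemma zpow_H_mem_R (n : ℤ) {z : Torus L} (hz : z ∈ Λ.R) :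
    (Λ.H ^ n : Equiv.Perm (Torus L)) z ∈ Λ.R := by
  induction n with
  | zero => exact hz
  | succ n ih =>
    rw [add_comm, zpow_add, zpow_one, Equiv.Perm.mul_apply]
    exact (Λ.H_mem_R_iff _).2 ih
  | pred n ih =>
    rw [sub_eq_add_neg, add_comm, zpow_add, zpow_neg_one, Equiv.Perm.mul_apply]
    rw [← Λ.H_mem_R_iff]
    simpa using ih

lemma isLocallyLinearAt_F {z : Torus L} (hz : z ∉ Λ.bdP) :
    IsLocallyLinearAt Λ.F z (planeMap 1 (Λ.p.slope z.2) 0 1) := by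
  have h1 : Tendsto (fun h : Tangent => h 1) (𝓝 0) (𝓝 0) := by
    simpa using (by fun_prop : Continuous fun h : Tangent => h 1).tendsto 0
  filter_upwards [h1.eventually (Λ.p.eventually_twist_add hz)] with h hh
  simp only [F, torusExp, Equiv.coe_fn_mk, hh, planeMap_apply_zero, planeMap_apply_one, one_mul,
    zero_mul, zero_add, AddCircle.coe_add]
  refine Prod.ext ?_ rfl
  dsimp only
  abel

lemma isLocallyLinearAt_G {z : Torus L} (hz : z ∉ Λ.bdQ) :
    IsLocallyLinearAt Λ.G z (planeMap 1 0 (Λ.q.slope z.1) 1) := by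
  have h0 : Tendsto (fun h : Tangent => h 0) (𝓝 0) (𝓝 0) := by
    simpa using (by fun_prop : Continuous fun h : Tangent => h 0).tendsto 0
  filter_upwards [h0.eventually (Λ.q.eventually_twist_add hz)] with h hh
  simp only [G, torusExp, Equiv.coe_fn_mk, hh, planeMap_apply_zero, planeMap_apply_one, one_mul,
    zero_mul, add_zero, AddCircle.coe_add]
  refine Prod.ext rfl ?_
  dsimp only
  abel

/-- The horizontal shear of the derivative of `H` at `z`. -/
noncomputable def shearF (z : Torus L) : ℝ := Λ.p.slope z.2

/-- The vertical shear of the derivative of `H` at `z`. -/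
noncomputable def shearG (z : Torus L) : ℝ := Λ.q.slope (Λ.F z).1

/-- The derivative of `H`. -/
noncomputable def derivH (z : Torus L) : Tangent →L[ℝ] Tangent :=
  planeMap 1 (Λ.shearF z) (Λ.shearG z) (1 + Λ.shearF z * Λ.shearG z)

/-- The derivative of `H⁻¹`. -/
noncomputable def derivHInv (z : Torus L) : Tangent →L[ℝ] Tangent :=
  planeMap (1 + Λ.shearF (Λ.H⁻¹ z) * Λ.shearG (Λ.H⁻¹ z)) (-Λ.shearF (Λ.H⁻¹ z))
    (-Λ.shearG (Λ.H⁻¹ z)) 1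

lemma H_inv_apply_H (z : Torus L) : Λ.H⁻¹ (Λ.H z) = z := Λ.H.symm_apply_apply z

lemma H_apply_H_inv (z : Torus L) : Λ.H (Λ.H⁻¹ z) = z := Λ.H.apply_symm_apply z

lemma derivH_derivHInv (z : Torus L) (v : Tangent) : Λ.derivH z (Λ.derivHInv (Λ.H z) v) = v := by
  apply tangent_ext <;>
    simp only [derivH, derivHInv, planeMap_apply_zero, planeMap_apply_one,
      H_inv_apply_H] <;> ring

lemma derivHInv_derivH (z : Torus L) (v : Tangent) : Λ.derivHInv (Λ.H z) (Λ.derivH z v) = v := by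
  apply tangent_ext <;>
    simp only [derivH, derivHInv, planeMap_apply_zero, planeMap_apply_one,
      H_inv_apply_H] <;> ring

lemma areaForm_derivH (z : Torus L) (v w : Tangent) :
    areaForm (Λ.derivH z v) (Λ.derivH z w) = areaForm v w :=
  areaForm_planeMap (by ring) v w

lemma areaForm_derivHInv (z : Torus L) (v w : Tangent) :
    areaForm (Λ.derivHInv z v) (Λ.derivHInv z w) = areaForm v w :=
  areaForm_planeMap (by ring) v w

lemma isLocallyLinearAt_H {z : Torus L} (hz : z ∉ Λ.s₀) :
    IsLocallyLinearAt Λ.H z (Λ.derivH z) := by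
  have h := (Λ.isLocallyLinearAt_G (z := Λ.F z) fun h => hz (.inr h)).comp
    (Λ.isLocallyLinearAt_F fun h => hz (.inl h))
  suffices hD : Λ.derivH z = (planeMap 1 0 (Λ.q.slope (Λ.F z).1) 1).comp
      (planeMap 1 (Λ.p.slope z.2) 0 1) by
    rw [hD]
    exact h
  ext1 v
  apply tangent_ext <;>
    simp only [derivH, shearF, shearG, ContinuousLinearMap.comp_apply, planeMap_apply_zero,
      planeMap_apply_one] <;> ring

lemma isLocallyLinearAt_H_inv {z : Torus L} (hz : Λ.H⁻¹ z ∉ Λ.s₀) :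
    IsLocallyLinearAt (Λ.H⁻¹ : Equiv.Perm (Torus L)) z (Λ.derivHInv z) := by
  have h := (Λ.isLocallyLinearAt_H hz).inv (Λ.derivH_derivHInv _)
  rwa [H_apply_H_inv] at h

lemma measurable_F : Measurable Λ.F :=
  (measurable_fst.add (Λ.p.measurable_twist.comp measurable_snd)).prodMk measurable_snd

lemma measurable_F_inv : Measurable (Λ.F⁻¹ : Equiv.Perm (Torus L)) :=
  (measurable_fst.sub (Λ.p.measurable_twist.comp measurable_snd)).prodMk measurable_snd

lemma measurable_G : Measurable Λ.G :=
  measurable_fst.prodMk (measurable_snd.add (Λ.q.measurable_twist.comp measurable_fst))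

lemma measurable_G_inv : Measurable (Λ.G⁻¹ : Equiv.Perm (Torus L)) :=
  measurable_fst.prodMk (measurable_snd.sub (Λ.q.measurable_twist.comp measurable_fst))

lemma measurable_H : Measurable Λ.H := Λ.measurable_G.comp Λ.measurable_F

lemma measurable_H_inv : Measurable (Λ.H⁻¹ : Equiv.Perm (Torus L)) := by
  rw [H, mul_inv_rev]
  exact Λ.measurable_F_inv.comp Λ.measurable_G_inv

lemma measurePreserving_G : MeasurePreserving Λ.G volume volume :=
  (MeasurePreserving.id volume).skew_product
    (g := fun x y => y + Λ.q.twist x)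
    (measurable_snd.add (Λ.q.measurable_twist.comp measurable_fst))
    (.of_forall fun x => map_add_right_eq_self volume (Λ.q.twist x))

/-- Conjugation by the swap of coordinates turns the horizontal shear into a skew product over the
first coordinate. -/
lemma measurePreserving_F : MeasurePreserving Λ.F volume volume := by
  have h : MeasurePreserving (fun z : Torus L => (z.1, z.2 + Λ.p.twist z.1)) volume volume :=
    (MeasurePreserving.id volume).skew_product
      (g := fun x y => y + Λ.p.twist x)
      (measurable_snd.add (Λ.p.measurable_twist.comp measurable_fst))
      (.of_forall fun x => map_add_right_eq_self volume (Λ.p.twist x))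
  have hs : MeasurePreserving (Prod.swap : Torus L → Torus L) volume volume :=
    Measure.measurePreserving_swap
  exact hs.comp (h.comp hs)

lemma measurePreserving_H : MeasurePreserving Λ.H volume volume :=
  Λ.measurePreserving_G.comp Λ.measurePreserving_F

lemma measurePreserving_H_inv :
    MeasurePreserving (Λ.H⁻¹ : Equiv.Perm (Torus L)) volume volume :=
  MeasurePreserving.symm
    { toEquiv := Λ.H, measurable_toFun := Λ.measurable_H, measurable_invFun := Λ.measurable_H_inv }
    Λ.measurePreserving_H

lemma volume_singleton_addCircle (y : AddCircle L) : volume ({y} : Set (AddCircle L)) = 0 := by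
  have h := AddCircle.volume_closedBall L (x := y) 0
  have hL : 0 < L := Fact.out
  simpa [hL.le] using h

lemma volume_endpoints (T : TwistData L) : volume T.endpoints = 0 := by
  rw [← Set.biUnion_of_singleton T.endpoints,
    measure_biUnion_null_iff T.finite_endpoints.countable]
  exact fun y _ => volume_singleton_addCircle y

/-- Each part is a preimage of finitely many points of the circle, under a coordinate projection
composed in one case with the measure-preserving `F`. -/
lemma volume_s₀ : volume Λ.s₀ = 0 := by
  refine measure_union_null ?_ ?_
  · exact Measure.quasiMeasurePreserving_snd.preimage_null (volume_endpoints Λ.p)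
  · exact Λ.measurePreserving_F.quasiMeasurePreserving.preimage_null
      (Measure.quasiMeasurePreserving_fst.preimage_null (volume_endpoints Λ.q))

lemma measurable_shearF : Measurable Λ.shearF := Λ.p.measurable_slope.comp measurable_snd

lemma measurable_shearG : Measurable Λ.shearG :=
  Λ.q.measurable_slope.comp (measurable_fst.comp Λ.measurable_F)

/-- Almost every point has a full orbit that avoids `s₀`. -/
lemma ae_zpow_H_notMem_s₀ :
    ∀ᵐ z : Torus L, ∀ n : ℤ, (Λ.H ^ n : Equiv.Perm (Torus L)) z ∉ Λ.s₀ := by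
  have h0 : ∀ᵐ z : Torus L, z ∉ Λ.s₀ := measure_eq_zero_iff_ae_notMem.1 Λ.volume_s₀
  rw [ae_all_iff]
  intro n
  obtain ⟨m, rfl | rfl⟩ := n.eq_nat_or_neg
  · have := (Λ.measurePreserving_H.iterate m).quasiMeasurePreserving.ae h0
    simpa [Equiv.Perm.iterate_eq_pow] using this
  · have := (Λ.measurePreserving_H_inv.iterate m).quasiMeasurePreserving.ae h0
    simpa only [Equiv.Perm.iterate_eq_pow, inv_pow, zpow_neg, zpow_natCast] using this

end LinkedTwist

/-! ### Direction vectors in the first and second quadrants -/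

section DirectionVectors

/-- The vector of the first quadrant with direction coordinate `s`. -/
noncomputable def expandingVec (s : ℝ) : Tangent := !₂[1 - s, s]

/-- The vector of the second quadrant with direction coordinate `t`. -/
noncomputable def contractingVec (t : ℝ) : Tangent := !₂[-(1 - t), t]

lemma areaForm_expandingVec_contractingVec (s t : ℝ) :
    areaForm (expandingVec s) (contractingVec t) = (1 - s) * t + s * (1 - t) := by
  simp [areaForm, expandingVec, contractingVec]
  ring

lemma areaForm_contractingVec_expandingVec (s t : ℝ) :
    areaForm (contractingVec t) (expandingVec s) = -((1 - s) * t + s * (1 - t)) := by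
  simp [areaForm, expandingVec, contractingVec]
  ring

lemma one_le_two_mul_norm {v : Tangent} (h : |v 0| + |v 1| = 1) : 1 ≤ 2 * ‖v‖ := by
  linarith [abs_coord_le_norm v 0, abs_coord_le_norm v 1]

lemma norm_le_two {v : Tangent} (h : |v 0| + |v 1| = 1) : ‖v‖ ≤ 2 := by
  linarith [norm_le_abs_add_abs v]

lemma abs_add_abs_expandingVec {s : ℝ} (hs : s ∈ Set.Icc (0 : ℝ) 1) :
    |expandingVec s 0| + |expandingVec s 1| = 1 := by
  simp [expandingVec, abs_of_nonneg hs.1, abs_of_nonneg (sub_nonneg.2 hs.2)]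

lemma abs_add_abs_contractingVec {t : ℝ} (ht : t ∈ Set.Icc (0 : ℝ) 1) :
    |contractingVec t 0| + |contractingVec t 1| = 1 := by
  have : |t - 1| = 1 - t := by rw [abs_sub_comm, abs_of_nonneg (sub_nonneg.2 ht.2)]
  simp [contractingVec, abs_of_nonneg ht.1, this]

/-- Both summands are non-negative. Applied to an invariant field, this shows that an image
direction along the first axis forces the original direction onto that axis and the vertical shear
to vanish. -/
lemma eq_zero_of_direction_eq_zero {c d s : ℝ} (hc : 0 ≤ c) (hd : 1 ≤ d)
    (hs : s ∈ Set.Icc (0 : ℝ) 1) (h : c * (1 - s) + d * s = 0) : s = 0 ∧ c = 0 := by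
  have h1 : 0 ≤ c * (1 - s) := mul_nonneg hc (sub_nonneg.2 hs.2)
  have h2 : s ≤ d * s := le_mul_of_one_le_left hs.1 hd
  have h3 : s = 0 := le_antisymm (by linarith) hs.1
  subst h3
  exact ⟨rfl, by linarith⟩

lemma eq_zero_of_direction_eq_one {a b s : ℝ} (ha : 1 ≤ a) (hb : 0 ≤ b)
    (hs : s ∈ Set.Icc (0 : ℝ) 1) (h : a * (1 - s) + b * s = 0) : s = 1 ∧ b = 0 := by
  have h' := eq_zero_of_direction_eq_zero (c := b) (d := a) (s := 1 - s) hb ha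
    ⟨sub_nonneg.2 hs.2, by linarith [hs.1]⟩ (by linarith)
  exact ⟨by linarith [h'.1], h'.2⟩

/-- The directions `(1 - s, s)` and `(-(1 - t), t)` agree only along a coordinate axis. -/
lemma eq_zero_or_eq_one_of_areaForm_eq_zero {s t : ℝ} (hs : s ∈ Set.Icc (0 : ℝ) 1)
    (ht : t ∈ Set.Icc (0 : ℝ) 1) (h : (1 - s) * t + s * (1 - t) = 0) :
    (s = 0 ∧ t = 0) ∨ (s = 1 ∧ t = 1) := by
  have h1 : 0 ≤ (1 - s) * t := mul_nonneg (sub_nonneg.2 hs.2) ht.1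
  have h2 : 0 ≤ s * (1 - t) := mul_nonneg hs.1 (sub_nonneg.2 ht.2)
  have h3 : (1 - s) * t = 0 := by linarith
  have h4 : s * (1 - t) = 0 := by linarith
  rcases mul_eq_zero.1 h3 with h5 | h5
  · exact .inr ⟨by linarith, by nlinarith⟩
  · subst h5
    exact .inl ⟨by linarith, rfl⟩

end DirectionVectors

/-! ### The invariant splitting and its growth rates -/

namespace LinkedTwist

variable {L : ℝ} (Λ : LinkedTwist L) [Fact (0 < L)]

lemma abs_shearF_le (z : Torus L) : |Λ.shearF z| ≤ Λ.p.slopeBound := by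
  rw [shearF, abs_of_nonneg (Λ.p.slope_nonneg _)]
  exact Λ.p.slope_le _

lemma abs_shearG_le (z : Torus L) : |Λ.shearG z| ≤ Λ.q.slopeBound := by
  rw [shearG, abs_of_nonneg (Λ.q.slope_nonneg _)]
  exact Λ.q.slope_le _

/-- An upper bound for the sum of the entries of the derivative of `H`. -/
noncomputable def derivBound : ℝ :=
  2 + Λ.p.slopeBound + Λ.q.slopeBound + Λ.p.slopeBound * Λ.q.slopeBound

lemma sum_entries_le (z : Torus L) :
    2 + Λ.shearF z + Λ.shearG z + Λ.shearF z * Λ.shearG z ≤ Λ.derivBound := by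
  have h1 : Λ.shearF z ≤ Λ.p.slopeBound := Λ.p.slope_le _
  have h2 : Λ.shearG z ≤ Λ.q.slopeBound := Λ.q.slope_le _
  have h3 : 0 ≤ Λ.shearF z := Λ.p.slope_nonneg _
  have h4 : 0 ≤ Λ.shearG z := Λ.q.slope_nonneg _
  have h5 := mul_le_mul h1 h2 h4 (h3.trans h1)
  rw [derivBound]
  linarith

/-- Fields of expanding directions `s` and contracting directions `t`, invariant under the
derivative of `H`, with their rates `r` and `q`. -/
structure Splitting (s t r q : Torus L → ℝ) : Prop where
  s_mem : ∀ z, s z ∈ Set.Icc (0 : ℝ) 1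
  t_mem : ∀ z, t z ∈ Set.Icc (0 : ℝ) 1
  measurable_r : Measurable r
  measurable_q : Measurable q
  one_le_r : ∀ z, 1 ≤ r z
  one_le_q : ∀ z, 1 ≤ q z
  r_le : ∀ z, r z ≤ Λ.derivBound
  q_le : ∀ z, q z ≤ Λ.derivBound
  derivH_expanding : ∀ z, Λ.derivH z (expandingVec (s z)) = r z • expandingVec (s (Λ.H z))
  derivHInv_contracting : ∀ z,
    Λ.derivHInv z (contractingVec (t z)) = q z • contractingVec (t (Λ.H⁻¹ z))
  s_eq_zero : ∀ z, s (Λ.H z) = 0 → s z = 0 ∧ Λ.shearG z = 0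
  s_eq_one : ∀ z, s (Λ.H z) = 1 → s z = 1 ∧ Λ.shearF z = 0
  t_eq_zero : ∀ z, t z = 0 → t (Λ.H z) = 0 ∧ Λ.shearG z = 0
  t_eq_one : ∀ z, t z = 1 → t (Λ.H z) = 1 ∧ Λ.shearF z = 0

lemma exists_splitting : ∃ s t r q : Torus L → ℝ, Λ.Splitting s t r q := by
  have hF (z : Torus L) : 0 ≤ Λ.shearF z := Λ.p.slope_nonneg _
  have hG (z : Torus L) : 0 ≤ Λ.shearG z := Λ.q.slope_nonneg _
  have hFG (z : Torus L) : 0 ≤ Λ.shearF z * Λ.shearG z := mul_nonneg (hF z) (hG z)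
  have hFm := Λ.measurable_shearF
  have hGm := Λ.measurable_shearG
  have hFm' := hFm.comp Λ.measurable_H_inv
  have hGm' := hGm.comp Λ.measurable_H_inv
  obtain ⟨s, r, hr, hs, hrb, hs0, hs1⟩ := exists_measurable_invariant_direction (φ := Λ.H)
    (a := fun _ => 1) (b := Λ.shearF) (c := Λ.shearG) (d := fun z => 1 + Λ.shearF z * Λ.shearG z)
    Λ.measurable_H_inv measurable_const hFm hGm (measurable_const.add (hFm.mul hGm))
    fun z => ⟨le_rfl, hF z, hG z, by linarith [hFG z], by ring⟩
  -- The inverse derivative has non-positive off-diagonal entries. Reflecting the first coordinate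
  -- makes them non-negative, which is why its invariant field is given by `contractingVec`, in the
  -- second quadrant.
  obtain ⟨t, q, hq, ht, hqb, ht0, ht1⟩ := exists_measurable_invariant_direction (φ := Λ.H⁻¹)
    (a := fun z => 1 + Λ.shearF (Λ.H⁻¹ z) * Λ.shearG (Λ.H⁻¹ z)) (b := fun z => Λ.shearF (Λ.H⁻¹ z))
    (c := fun z => Λ.shearG (Λ.H⁻¹ z)) (d := fun _ => 1)
    (by rw [inv_inv]; exact Λ.measurable_H) (measurable_const.add (hFm'.mul hGm')) hFm' hGm'
    measurable_const fun z => ⟨by linarith [hFG (Λ.H⁻¹ z)], hF _, hG _, le_rfl, by ring⟩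
  refine ⟨s, t, r, q, hs, ht, hr, hq, fun z => (hrb z).1, fun z => (hqb z).1, fun z => ?_,
    fun z => ?_, fun z => ?_, fun z => ?_, fun z h => ?_, fun z h => ?_, fun z h => ?_,
    fun z h => ?_⟩
  · linarith [(hrb z).2, Λ.sum_entries_le z]
  · linarith [(hqb z).2, Λ.sum_entries_le (Λ.H⁻¹ z)]
  · apply tangent_ext
    · simpa [derivH, expandingVec] using hs0 z
    · simpa [derivH, expandingVec] using hs1 z
  · have h0 := ht0 z
    have h1 := ht1 z
    apply tangent_ext <;>
      simp only [derivHInv, contractingVec, planeMap_apply_zero, planeMap_apply_one,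
        PiLp.smul_apply, smul_eq_mul, Matrix.cons_val_zero, Matrix.cons_val_one] <;> linarith
  · have h1 := hs1 z
    rw [h, mul_zero] at h1
    exact eq_zero_of_direction_eq_zero (hG z) (by linarith [hFG z]) (hs z) h1
  · have h0 := hs0 z
    rw [h, sub_self, mul_zero] at h0
    exact eq_zero_of_direction_eq_one le_rfl (hF z) (hs z) h0
  · have h1 := ht1 (Λ.H z)
    rw [H_inv_apply_H, h, mul_zero] at h1
    exact eq_zero_of_direction_eq_zero (hG z) le_rfl (ht _) h1
  · have h0 := ht0 (Λ.H z)
    rw [H_inv_apply_H, h, sub_self, mul_zero] at h0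
    exact eq_zero_of_direction_eq_one (by linarith [hFG z]) (hF z) (ht _) h0

namespace Splitting

variable {Λ} {s t r q : Torus L → ℝ}

/-- This inverts the invariance relation under the derivative of `H⁻¹`. The rate is at most one,
which provides the bounded direction for the transversality argument. -/
lemma derivH_contracting (S : Λ.Splitting s t r q) (z : Torus L) :
    Λ.derivH z (contractingVec (t z)) = (q (Λ.H z))⁻¹ • contractingVec (t (Λ.H z)) := by
  have h := congrArg (Λ.derivH z) (S.derivHInv_contracting (Λ.H z))
  rw [derivH_derivHInv, H_inv_apply_H, map_smul] at h
  rw [h, inv_smul_smul₀ (by linarith [S.one_le_q (Λ.H z)])]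

lemma derivHInv_expanding (S : Λ.Splitting s t r q) (z : Torus L) :
    Λ.derivHInv z (expandingVec (s z)) = (r (Λ.H⁻¹ z))⁻¹ • expandingVec (s (Λ.H⁻¹ z)) := by
  have h := congrArg (Λ.derivHInv z) (S.derivH_expanding (Λ.H⁻¹ z))
  have h' := Λ.derivHInv_derivH (Λ.H⁻¹ z) (expandingVec (s (Λ.H⁻¹ z)))
  rw [H_apply_H_inv] at h h'
  rw [h', map_smul] at h
  rw [h, inv_smul_smul₀ (by linarith [S.one_le_r (Λ.H⁻¹ z)])]

/-- The condition `t = 0` propagates forward and annihilates every vertical shear, leaving a product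
of bounded horizontal shears. -/
lemma tendsto_forward_of_eq_zero (S : Λ.Splitting s t r q) {z : Torus L} (hz : t z = 0)
    {v : Tangent} (hv : v ≠ 0) :
    Tendsto (fun n : ℕ => 1 / (n : ℝ) * Real.log ‖cocycle Λ.H Λ.derivH n z v‖) atTop (𝓝 0) := by
  have ht (n : ℕ) : t (Λ.H^[n] z) = 0 := by
    induction n with
    | zero => exact hz
    | succ n ih => rw [Function.iterate_succ_apply']; exact (S.t_eq_zero _ ih).1
  have hn (n : ℕ) : Λ.shearG (Λ.H^[n] z) = 0 := (S.t_eq_zero _ (ht n)).2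
  exact tendsto_log_norm_of_shears (i := 0) (j := 1) (by decide)
    (w := fun n => cocycle Λ.H Λ.derivH n z v) (a := fun n => Λ.shearF (Λ.H^[n] z))
    (fun n => Λ.abs_shearF_le _) (fun n => by simp [cocycle, derivH, hn n])
    (fun n => by simp [cocycle, derivH]) hv

lemma tendsto_forward_of_eq_one (S : Λ.Splitting s t r q) {z : Torus L} (hz : t z = 1)
    {v : Tangent} (hv : v ≠ 0) :
    Tendsto (fun n : ℕ => 1 / (n : ℝ) * Real.log ‖cocycle Λ.H Λ.derivH n z v‖) atTop (𝓝 0) := by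
  have ht (n : ℕ) : t (Λ.H^[n] z) = 1 := by
    induction n with
    | zero => exact hz
    | succ n ih => rw [Function.iterate_succ_apply']; exact (S.t_eq_one _ ih).1
  have hn (n : ℕ) : Λ.shearF (Λ.H^[n] z) = 0 := (S.t_eq_one _ (ht n)).2
  exact tendsto_log_norm_of_shears (i := 1) (j := 0) (by decide)
    (w := fun n => cocycle Λ.H Λ.derivH n z v) (a := fun n => Λ.shearG (Λ.H^[n] z))
    (fun n => Λ.abs_shearG_le _) (fun n => by simp [cocycle, derivH, hn n])
    (fun n => by simp [cocycle, derivH, hn n, add_comm]) hv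

/-- The condition `s = 0` propagates backward, in contrast to `t = 0`, and again only horizontal
shears remain. -/
lemma tendsto_backward_of_eq_zero (S : Λ.Splitting s t r q) {z : Torus L} (hz : s z = 0)
    {v : Tangent} (hv : v ≠ 0) :
    Tendsto (fun n : ℕ => 1 / (n : ℝ) *
      Real.log ‖cocycle (Λ.H⁻¹ : Equiv.Perm (Torus L)) Λ.derivHInv n z v‖) atTop (𝓝 0) := by
  set φ : Equiv.Perm (Torus L) := Λ.H⁻¹ with hφ
  have hs (w : Torus L) (hw : s w = 0) : s (φ w) = 0 ∧ Λ.shearG (φ w) = 0 :=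
    S.s_eq_zero _ (by rw [hφ, H_apply_H_inv, hw])
  have ht (n : ℕ) : s (φ^[n] z) = 0 := by
    induction n with
    | zero => exact hz
    | succ n ih => rw [Function.iterate_succ_apply']; exact (hs _ ih).1
  have hn (n : ℕ) : Λ.shearG (φ (φ^[n] z)) = 0 := (hs _ (ht n)).2
  exact tendsto_log_norm_of_shears (i := 0) (j := 1) (by decide)
    (w := fun n => cocycle φ Λ.derivHInv n z v) (a := fun n => -Λ.shearF (φ (φ^[n] z)))
    (fun n => by rw [abs_neg]; exact Λ.abs_shearF_le _)
    (fun n => by simp only [cocycle, derivHInv, ContinuousLinearMap.comp_apply,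
      planeMap_apply_one, ← hφ, hn n]; ring)
    (fun n => by simp only [cocycle, derivHInv, ContinuousLinearMap.comp_apply,
      planeMap_apply_zero, ← hφ, hn n]; ring) hv

lemma tendsto_backward_of_eq_one (S : Λ.Splitting s t r q) {z : Torus L} (hz : s z = 1)
    {v : Tangent} (hv : v ≠ 0) :
    Tendsto (fun n : ℕ => 1 / (n : ℝ) *
      Real.log ‖cocycle (Λ.H⁻¹ : Equiv.Perm (Torus L)) Λ.derivHInv n z v‖) atTop (𝓝 0) := by
  set φ : Equiv.Perm (Torus L) := Λ.H⁻¹ with hφ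
  have hs (w : Torus L) (hw : s w = 1) : s (φ w) = 1 ∧ Λ.shearF (φ w) = 0 :=
    S.s_eq_one _ (by rw [hφ, H_apply_H_inv, hw])
  have ht (n : ℕ) : s (φ^[n] z) = 1 := by
    induction n with
    | zero => exact hz
    | succ n ih => rw [Function.iterate_succ_apply']; exact (hs _ ih).1
  have hn (n : ℕ) : Λ.shearF (φ (φ^[n] z)) = 0 := (hs _ (ht n)).2
  exact tendsto_log_norm_of_shears (i := 1) (j := 0) (by decide)
    (w := fun n => cocycle φ Λ.derivHInv n z v) (a := fun n => -Λ.shearG (φ (φ^[n] z)))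
    (fun n => by rw [abs_neg]; exact Λ.abs_shearG_le _)
    (fun n => by simp only [cocycle, derivHInv, ContinuousLinearMap.comp_apply,
      planeMap_apply_zero, ← hφ, hn n]; ring)
    (fun n => by simp only [cocycle, derivHInv, ContinuousLinearMap.comp_apply,
      planeMap_apply_one, ← hφ]; ring) hv

/-- Almost everywhere, the derivatives of the forward and backward iterates of `H` have exponential
growth rates along all directions. -/
lemma ae_exists_growth_rates (S : Λ.Splitting s t r q) :
    ∀ᵐ z : Torus L, ∀ v : Tangent, v ≠ 0 →
      (∃ l : ℝ, Tendsto (fun n : ℕ => 1 / (n : ℝ) * Real.log ‖cocycle Λ.H Λ.derivH n z v‖)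
        atTop (𝓝 l)) ∧
      (∃ l : ℝ, Tendsto (fun n : ℕ => 1 / (n : ℝ) *
        Real.log ‖cocycle (Λ.H⁻¹ : Equiv.Perm (Torus L)) Λ.derivHInv n z v‖) atTop (𝓝 l)) := by
  have hr0 (z : Torus L) : 0 < r z := one_pos.trans_le (S.one_le_r z)
  have hq0 (z : Torus L) : 0 < q z := one_pos.trans_le (S.one_le_q z)
  have hlog {x : ℝ} (h1 : 1 ≤ x) (h2 : x ≤ Λ.derivBound) :
      |Real.log x| ≤ Real.log Λ.derivBound := by
    rw [abs_of_nonneg (Real.log_nonneg h1)]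
    exact Real.log_le_log (by linarith) h2
  have hlog' {x : ℝ} (h1 : 1 ≤ x) (h2 : x ≤ Λ.derivBound) :
      |Real.log x⁻¹| ≤ Real.log Λ.derivBound := by
    rw [Real.log_inv, abs_neg]
    exact hlog h1 h2
  filter_upwards [
    ae_exists_tendsto_birkhoffAverage Λ.measurePreserving_H S.measurable_r.log
      (fun z => hlog (S.one_le_r z) (S.r_le z)),
    ae_exists_tendsto_birkhoffAverage Λ.measurePreserving_H
      (S.measurable_q.comp Λ.measurable_H).inv.log
      (fun z => hlog' (S.one_le_q (Λ.H z)) (S.q_le (Λ.H z))),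
    ae_exists_tendsto_birkhoffAverage Λ.measurePreserving_H_inv S.measurable_q.log
      (fun z => hlog (S.one_le_q z) (S.q_le z)),
    ae_exists_tendsto_birkhoffAverage Λ.measurePreserving_H_inv
      (S.measurable_r.comp Λ.measurable_H_inv).inv.log
      (fun z => hlog' (S.one_le_r (Λ.H⁻¹ z)) (S.r_le (Λ.H⁻¹ z)))] with z h1 h2 h3 h4 v hv
  -- This quantity is the area spanned by the two invariant directions. If it vanishes, both lie on
  -- one axis: `t` then controls the forward orbit and `s` the backward one.
  by_cases hz : (1 - s z) * t z + s z * (1 - t z) = 0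
  · rcases eq_zero_or_eq_one_of_areaForm_eq_zero (S.s_mem z) (S.t_mem z) hz with h | h
    · exact ⟨⟨0, S.tendsto_forward_of_eq_zero h.2 hv⟩, ⟨0, S.tendsto_backward_of_eq_zero h.1 hv⟩⟩
    · exact ⟨⟨0, S.tendsto_forward_of_eq_one h.2 hv⟩, ⟨0, S.tendsto_backward_of_eq_one h.1 hv⟩⟩
  · have he (z : Torus L) := abs_add_abs_expandingVec (S.s_mem z)
    have hf (z : Torus L) := abs_add_abs_contractingVec (S.t_mem z)
    constructor
    · exact exists_tendsto_log_norm_cocycle Λ.areaForm_derivH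
        (e := fun z => expandingVec (s z)) (f := fun z => contractingVec (t z))
        (q := fun z => (q (Λ.H z))⁻¹) hr0 (fun z => inv_pos.2 (hq0 _))
        (fun z => inv_le_one_of_one_le₀ (S.one_le_q _)) S.derivH_expanding S.derivH_contracting
        two_pos (fun z => one_le_two_mul_norm (he z)) (fun z => norm_le_two (he z))
        (fun z => one_le_two_mul_norm (hf z)) (fun z => norm_le_two (hf z))
        (by rwa [areaForm_expandingVec_contractingVec]) h1 h2 hv
    -- For `H⁻¹` the second-quadrant field expands and the first-quadrant field contracts.
    · exact exists_tendsto_log_norm_cocycle Λ.areaForm_derivHInv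
        (e := fun z => contractingVec (t z)) (f := fun z => expandingVec (s z))
        (q := fun z => (r (Λ.H⁻¹ z))⁻¹) hq0 (fun z => inv_pos.2 (hr0 _))
        (fun z => inv_le_one_of_one_le₀ (S.one_le_r _)) S.derivHInv_contracting
        S.derivHInv_expanding two_pos (fun z => one_le_two_mul_norm (hf z))
        (fun z => norm_le_two (hf z)) (fun z => one_le_two_mul_norm (he z))
        (fun z => norm_le_two (he z))
        (by rwa [areaForm_contractingVec_expandingVec, neg_ne_zero]) h3 h4 hv

end Splitting

/-! ### Orbits avoiding the singular set and the conclusion -/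

lemma mem_J_of_orbit {z : Torus L} (hR : z ∈ Λ.R)
    (hz : ∀ n : ℤ, (Λ.H ^ n : Equiv.Perm (Torus L)) z ∉ Λ.s₀) : z ∈ Λ.J := by
  -- Membership of the preimage in `N` also requires its image under `H` to avoid `s₀`; this is the
  -- orbit condition at the exponent `1 + -i`.
  refine Set.mem_iInter.2 fun i => ⟨(Λ.H ^ (-i) : Equiv.Perm (Torus L)) z,
    ⟨⟨Λ.zpow_H_mem_R _ hR, hz _⟩, fun h => hz (1 + -i) ?_⟩, ?_⟩
  · rw [zpow_add, zpow_one]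
    exact h
  · rw [← Equiv.Perm.mul_apply, ← zpow_add, add_neg_cancel, zpow_zero, Equiv.Perm.one_apply]

lemma isLocallyLinearAt_zpow {z : Torus L}
    (hz : ∀ n : ℤ, (Λ.H ^ n : Equiv.Perm (Torus L)) z ∉ Λ.s₀) (n : ℕ) :
    IsLocallyLinearAt (Λ.H ^ (n : ℤ) : Equiv.Perm (Torus L)) z (cocycle Λ.H Λ.derivH n z) ∧
    IsLocallyLinearAt (Λ.H ^ (-n : ℤ) : Equiv.Perm (Torus L)) z
      (cocycle (Λ.H⁻¹ : Equiv.Perm (Torus L)) Λ.derivHInv n z) := by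
  constructor
  · rw [zpow_natCast, ← Equiv.Perm.iterate_eq_pow]
    refine isLocallyLinearAt_iterate (fun m => Λ.isLocallyLinearAt_H ?_) n
    rw [Equiv.Perm.iterate_eq_pow, ← zpow_natCast]
    exact hz m
  · rw [zpow_neg, zpow_natCast, ← inv_pow, ← Equiv.Perm.iterate_eq_pow]
    -- Local linearity of `H⁻¹` at the `m`-th backward iterate needs the next one, of exponent `-(m
    -- + 1)`, to avoid `s₀`.
    refine isLocallyLinearAt_iterate (fun m => Λ.isLocallyLinearAt_H_inv ?_) n
    rw [Equiv.Perm.iterate_eq_pow, ← Equiv.Perm.mul_apply, ← pow_succ', inv_pow, ← zpow_natCast,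
      ← zpow_neg]
    exact hz _

end LinkedTwist

theorem mainTheorem4 (L : ℝ) [Fact (0 < L)] (Λ : LinkedTwist L) :
    ∀ᵐ z ∂Λ.μ,
      z ∈ Λ.J ∧
      (∀ n : ℤ, TorusDifferentiableAt (Λ.H ^ n : Equiv.Perm (Torus L)) z) ∧
      ∀ v : Tangent, v ≠ 0 →
        (∃ χ : ℝ, IsLyapunovExponent Λ.H Filter.atTop z v χ) ∧
        (∃ χ : ℝ, IsLyapunovExponent Λ.H Filter.atBot z v χ) := by
  obtain ⟨s, t, r, q, S⟩ := Λ.exists_splitting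
  have hac : Λ.μ ≪ volume := ProbabilityTheory.cond_absolutelyContinuous
  filter_upwards [ProbabilityTheory.ae_cond_mem Λ.measurableSet_R,
    hac.ae_le Λ.ae_zpow_H_notMem_s₀, hac.ae_le S.ae_exists_growth_rates] with z hR hz hgrowth
  have hlin := Λ.isLocallyLinearAt_zpow hz
  refine ⟨Λ.mem_J_of_orbit hR hz, fun n => ?_, fun v hv => ?_⟩
  · obtain ⟨m, rfl | rfl⟩ := n.eq_nat_or_neg
    · exact (hlin m).1.hasFDerivAt.differentiableAt
    · exact (hlin m).2.hasFDerivAt.differentiableAt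
  · obtain ⟨⟨l, hl⟩, ⟨l', hl'⟩⟩ := hgrowth v hv
    -- The growth rate of the inverse cocycle is normalized by the positive number of steps, whereas
    -- the backward exponent divides by a negative integer; hence the sign.
    refine ⟨⟨l, ?_⟩, ⟨-l', ?_⟩⟩
    · rw [IsLyapunovExponent, ← Nat.map_cast_int_atTop, tendsto_map'_iff]
      refine hl.congr fun n => ?_
      rw [Function.comp_apply, torusDeriv, (hlin n).1.hasFDerivAt.fderiv, Int.cast_natCast]
    · rw [IsLyapunovExponent, ← map_neg_atTop, ← Nat.map_cast_int_atTop, map_map,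
        tendsto_map'_iff]
      refine hl'.neg.congr fun n => ?_
      simp only [Function.comp_apply, torusDeriv, (hlin n).2.hasFDerivAt.fderiv, Int.cast_neg,
        Int.cast_natCast]
      rw [one_div_neg_eq_neg_one_div, neg_mul]
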